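/- Consider the planar system $\dot X=-Y,\ \dot Y=X^3-Y^3$. There is $\epsilon_0>0$ such that for every $\epsilon$ with $0<\epsilon<\epsilon_0$ the solution with $X(0)=\epsilon$, $Y(0)=0$ exists for all $t\ge 0$, it returns to the positive $X$-axis, and the abscissa $\tilde{\tilde X}$ of its first return is the sum of the convergent series $$\tilde{\tilde X}=\epsilon+\sum_{n=1}^\infty X_n\,\epsilon^{3n+1}.$$ The coefficients $X_n$ do not depend on $\epsilon$ and are computed iteratively as follows. Let $p(t)=4-6t^2+4t^4-t^6$, and define functions $v_n$ on $[0,1]$, $n\ge1$, by $v_n(0)=0$ and $$v_n(\xi)=\xi^{-2}\int_0^\xi t^4p(t)^{3/2}R_{n-1}(t)\,dt\qquad(0<\xi\le 1),$$ where $R_n(t)$ is the coefficient of $\delta^n$ in the formal expansion of $\bigl(1-\sum_{k\ge1}\delta^k v_k(t)/p(t)\bigr)^{3/2}$; it depends only on $v_1,\dots,v_n$, and $R_0=1$. Put $c_n=v_n(1)$. For a formal power series $E=1+\dots\in\mathbb R[[\alpha]]$ let $\mathcal M(E)=G=1+\dots\in\mathbb R[[\alpha]]$ be the unique formal power series with constant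 term $1$ and $$G^4\Bigl(1-\sum_{k\ge1}c_k(-2\alpha G^3)^k\Bigr)=E^4\Bigl(1-\sum_{k\ge1}c_k(2\alpha E^3)^k\Bigr),$$ whose coefficients are found one after the other by comparing the coefficients of $\alpha^n$. Then $X_n=2^{n/2}r_n$, where $\mathcal M(\mathcal M(1))=\sum_{n\ge0}r_n\alpha^n$. In particular, $$X_1=-2^{3/2}c_1,\qquad X_2=16\,c_1^2,\qquad X_3=-2^{3/2}\bigl(20\,c_2c_1+8\,c_3+49\,c_1^3\bigr),$$ and for $0<\xi\le1$ $$v_1(\xi)=\xi^{-2}\int_0^\xi t^4p(t)^{3/2}\,dt,\qquad v_2(\xi)=-\frac32\,\xi^{-2}\int_0^\xi t^4p(t)^{1/2}v_1(t)\,dt,$$ $$v_3(\xi)=\xi^{-2}\int_0^\xi t^4\left[-\frac32\,p(t)^{1/2}v_2(t)+\frac38\,\frac{v_1(t)^2}{p(t)^{1/2}}\right]dt .$$ -/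

import Mathlib

open Set

noncomputable section

namespace NilpotentFocus

/-- `(X, Y)` is a solution, for all times `t ≥ 0`, of `X' = -Y`, `Y' = X ^ 3 - Y ^ 3`
(one-sided derivative at the initial time `t = 0`). -/
structure IsForwardSolution (X Y : ℝ → ℝ) : Prop where
  deriv_fst : ∀ t ∈ Ici (0 : ℝ), HasDerivWithinAt X (-Y t) (Ici 0) t
  deriv_snd : ∀ t ∈ Ici (0 : ℝ), HasDerivWithinAt Y (X t ^ 3 - Y t ^ 3) (Ici 0) t

/-- `T` is the first positive time at which the curve `(X, Y)` is on the positive `X`-axis. -/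
structure IsFirstReturnTime (X Y : ℝ → ℝ) (T : ℝ) : Prop where
  pos : 0 < T
  fst_pos : 0 < X T
  snd_eq_zero : Y T = 0
  first : ∀ t ∈ Ioo 0 T, ¬ (0 < X t ∧ Y t = 0)

/-- The polynomial `p`. -/
def p (t : ℝ) : ℝ := 4 - 6 * t ^ 2 + 4 * t ^ 4 - t ^ 6

/-- The binomial coefficient `(3/2 choose j)`. -/
def binom (j : ℕ) : ℝ := (∏ i ∈ Finset.range j, ((3 : ℝ) / 2 - i)) / (j.factorial : ℝ)

/-- The coefficient of `δ ^ n` in the binomial expansion of `(1 - ∑_{k ≥ 1} δ ^ k * a k) ^ (3/2)`.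
Only `a 1, …, a n` enter; the powers `j > n` do not contribute. -/
def R (n : ℕ) (a : ℕ → ℝ) : ℝ :=
  ∑ j ∈ Finset.range (n + 1), binom j *
    PowerSeries.coeff n ((-(PowerSeries.mk fun k => if k = 0 then 0 else a k)) ^ j)

/-- The iterated integrals `v n`:
`v (n + 1) ξ = ξ⁻² ∫₀^ξ t ^ 4 * p t ^ (3/2) * R n (v 1 t / p t, …, v n t / p t) dt`. -/
def v : ℕ → ℝ → ℝ
  | 0 => fun _ => 0
  | n + 1 => fun ξ => (ξ ^ 2)⁻¹ * ∫ t in (0 : ℝ)..ξ, t ^ 4 * p t ^ (3 / 2 : ℝ) *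
      R n (fun k => if _h : k < n + 1 then v k t / p t else 0)
termination_by n => n

/-- The numbers `c n = v n 1`. -/
def c (n : ℕ) : ℝ := v n 1

/-- The formal power series `E ^ 4 * (1 - ∑_{1 ≤ k ≤ N} c k * (s * α * E ^ 3) ^ k)` in the variable
`α`. For `s = ± 2` and up to terms of order higher than `N`, it is the expansion of the square of
the height at which the arc through the point with abscissa `E` of the (rescaled) horizontal axis
meets the vertical axis. -/
def heightSq (N : ℕ) (s : ℝ) (E : PowerSeries ℝ) : PowerSeries ℝ :=
  E ^ 4 * (1 - ∑ k ∈ Finset.Icc 1 N, c k • (s • (PowerSeries.X * E ^ 3)) ^ k)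

/-- The coefficients of the formal power series `G = 1 + …` in `α` that solves the matching equation
`G ^ 4 * (1 - ∑_{k ≥ 1} c k * (-2 * α * G ^ 3) ^ k) = E ^ 4 * (1 - ∑_{k ≥ 1} c k * (2 * α * E ^ 3) ^ k)`,
computed one after the other: the unknown coefficient of `α ^ (n + 1)` enters the coefficient of
`α ^ (n + 1)` on the left-hand side only through four times itself. -/
def matchCoeff (E : PowerSeries ℝ) : ℕ → ℝ
  | 0 => 1
  | n + 1 => (1 / 4) * PowerSeries.coeff (n + 1)
      (heightSq (n + 1) 2 E -
        heightSq (n + 1) (-2)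
          (PowerSeries.mk fun k => if _h : k < n + 1 then matchCoeff E k else 0))
termination_by n => n

/-- The series in `α` of minus the abscissa of the first crossing of the negative horizontal axis
(in the variables in which the orbit starts at abscissa `1`). -/
def halfTurn : PowerSeries ℝ := PowerSeries.mk (matchCoeff 1)

/-- The series in `α` of the abscissa of the first return to the positive horizontal axis. -/
def fullTurn : PowerSeries ℝ := PowerSeries.mk (matchCoeff halfTurn)

/-- The coefficients of the return map in the original variables, where `α = √2 * ε ^ 3`. -/
def returnCoeff (n : ℕ) : ℝ := Real.sqrt 2 ^ n * PowerSeries.coeff n fullTurn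

end NilpotentFocus

end

/-! The energy `Y ^ 2 / 2 + X ^ 4 / 4` has derivative `-Y ^ 4`, so a small orbit is a perturbed
oval. It is cut into arcs at the axes. On an arc leaving the horizontal axis at abscissa `E`, put `x
= E * (1 - ξ ^ 2)` and `y ^ 2 = E ^ 4 / 2 * ξ ^ 2 * (p ξ - V ξ)`. The orbit equation becomes the
integral equation `ξ ^ 2 * V ξ = δ * ∫ t in 0..ξ, t ^ 4 * (p t - V t) ^ (3 / 2)` with `δ = 2 * √2 *
E ^ 3`, and the squared height on the vertical axis is `E ^ 4 / 2 * (1 - V 1)` (`sq_height_of_arc`).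
The arc that comes down to the negative axis is of the same kind after reversing time and reflecting
in the vertical axis, but the friction, hence `δ`, changes sign.

By the implicit function theorem in `C([0, 1])` the profile `V` is analytic in `δ`; comparing
coefficients shows that its Taylor coefficients are the `v n` (`v_eq_coeff`), so `C δ = V 1` has the
coefficients `c n`. Equating the two heights (`matching`) gives an analytic equation in `α = √2 * ε
^ 3` and the ratio `g` of the abscissas. Its solution near `g = 1` is unique and analytic: the
half-turn factor `Φ` (`exists_halfTurn`). The system is invariant under reflection at the origin, so
the second half turn uses the same `Φ` at `α * Φ α ^ 3`, and the return is `ε * Φ α * Φ (α * Φ α ^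
3)`. Both factors obey matching equations, which determine their formal series (`eq_mk_matchCoeff`).

Functions and formal series are linked by `HasExpansion`, an asymptotic expansion to all orders: it
respects sums and products, is unique, and for an analytic function is the Taylor series. Dynamics
enters through energy estimates, which force a crossing (`exists_crossing`) and place it near `g =
1`, and through global existence for small data. -/

namespace NilpotentFocus

/-! ### Asymptotic expansions at the origin -/

open Filter Topology Asymptotics

/-- The power series `P` is the asymptotic expansion of `f` at `0`. -/
def HasExpansion (f : ℝ → ℝ) (P : PowerSeries ℝ) : Prop :=
  ∀ n : ℕ, (fun x => f x - (P.trunc n).eval x) =O[𝓝 0] fun x => x ^ n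

namespace HasExpansion

variable {f g : ℝ → ℝ} {P Q : PowerSeries ℝ}

theorem isBigO_one (hf : HasExpansion f P) : f =O[𝓝 0] fun _ => (1 : ℝ) := by
  simpa using hf 0

theorem congr (hf : HasExpansion f P) (h : f =ᶠ[𝓝 0] g) : HasExpansion g P := fun n =>
  (hf n).congr' (h.mono fun x hx => by simp [hx]) EventuallyEq.rfl

theorem isBigO_eval_of_coeff {q : Polynomial ℝ} {n : ℕ} (h : ∀ k < n, q.coeff k = 0) :
    (fun x => q.eval x) =O[𝓝 (0 : ℝ)] fun x => x ^ n := by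
  obtain ⟨r, rfl⟩ := Polynomial.X_pow_dvd_iff.2 h
  have h1 : (fun x => r.eval x) =O[𝓝 (0 : ℝ)] fun _ => (1 : ℝ) :=
    r.continuous.continuousAt.isBigO_one ℝ
  simpa using (isBigO_refl (fun x : ℝ => x ^ n) (𝓝 0)).mul h1

theorem of_polynomial (q : Polynomial ℝ) : HasExpansion (fun x => q.eval x) q := fun n => by
  have h : ∀ k < n, (q - PowerSeries.trunc n (q : PowerSeries ℝ)).coeff k = 0 := fun k hk => by
    simp [PowerSeries.coeff_trunc, hk]
  simpa using isBigO_eval_of_coeff h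

theorem const (a : ℝ) : HasExpansion (fun _ => a) (PowerSeries.C a) := by
  simpa using of_polynomial (Polynomial.C a)

theorem one : HasExpansion (fun _ => 1) 1 := by
  simpa using of_polynomial 1

theorem id : HasExpansion (fun x => x) PowerSeries.X := by
  simpa using of_polynomial Polynomial.X

theorem add (hf : HasExpansion f P) (hg : HasExpansion g Q) :
    HasExpansion (fun x => f x + g x) (P + Q) := fun n => by
  refine ((hf n).add (hg n)).congr_left fun x => ?_
  simp only [map_add, Polynomial.eval_add]
  ring

theorem const_mul (hf : HasExpansion f P) (a : ℝ) : HasExpansion (fun x => a * f x) (a • P) :=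
  fun n => by
  refine ((hf n).const_mul_left a).congr_left fun x => ?_
  simp only [map_smul, Polynomial.eval_smul, smul_eq_mul]
  ring

theorem neg (hf : HasExpansion f P) : HasExpansion (fun x => -f x) (-P) := by
  simpa using hf.const_mul (-1)

theorem sub (hf : HasExpansion f P) (hg : HasExpansion g Q) :
    HasExpansion (fun x => f x - g x) (P - Q) := by
  simpa [sub_eq_add_neg] using hf.add hg.neg

theorem mul (hf : HasExpansion f P) (hg : HasExpansion g Q) :
    HasExpansion (fun x => f x * g x) (P * Q) := fun n => by
  have h1 := (hf n).mul hg.isBigO_one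
  have h2 := ((PowerSeries.trunc n P).continuous.continuousAt (x := 0)).isBigO_one ℝ
  have h3 := h2.mul (hg n)
  -- The product of the truncations overshoots degree `n`, but only by terms divisible by `x ^ n`.
  have h4 : ∀ k < n, (P.trunc n * Q.trunc n - (P * Q).trunc n).coeff k = 0 := fun k hk => by
    have := PowerSeries.coeff_mul_eq_coeff_trunc_mul_trunc P Q hk
    simp only [Polynomial.coeff_sub, PowerSeries.coeff_trunc, hk, if_true, this]
    rw [← Polynomial.coe_mul, Polynomial.coeff_coe, sub_self]
  have h5 := isBigO_eval_of_coeff h4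
  simp only [mul_one, one_mul] at h1 h3
  refine ((h1.add h3).add h5).congr_left fun x => ?_
  simp only [Polynomial.eval_sub, Polynomial.eval_mul]
  ring

theorem pow (hf : HasExpansion f P) (k : ℕ) : HasExpansion (fun x => f x ^ k) (P ^ k) := by
  induction k with
  | zero => simpa using one
  | succ k ih => simpa [pow_succ] using ih.mul hf

theorem sum {ι : Type*} {F : ι → ℝ → ℝ} {S : ι → PowerSeries ℝ} (s : Finset ι)
    (h : ∀ i, HasExpansion (F i) (S i)) :
    HasExpansion (fun x => ∑ i ∈ s, F i x) (∑ i ∈ s, S i) := by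
  classical
  induction s using Finset.induction_on with
  | empty => simpa using const 0
  | insert a s ha ih => simpa [Finset.sum_insert ha] using (h a).add ih

/-- Once the coefficients below `k` vanish, a nonzero `k`-th one would make `x ^ k` a big-O of `x ^
(k + 1)`. Uniqueness of expansions and every later comparison of coefficients rest on this. -/
theorem coeff_eq_zero (hf : HasExpansion f P) {n : ℕ} (h : f =O[𝓝 0] fun x => x ^ n) :
    ∀ k < n, PowerSeries.coeff k P = 0 := by
  intro k
  induction k using Nat.strong_induction_on with
  | _ k ih =>
    intro hk
    have h1 : (fun x : ℝ => x ^ n) =O[𝓝 0] fun x => x ^ (k + 1) := by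
      obtain ⟨m, rfl⟩ := Nat.exists_eq_add_of_le (Nat.succ_le_of_lt hk)
      have hm : (fun x : ℝ => x ^ m) =O[𝓝 0] fun _ => (1 : ℝ) :=
        (continuous_pow m).continuousAt.isBigO_one ℝ
      simpa [pow_add] using (isBigO_refl (fun x : ℝ => x ^ (k + 1)) (𝓝 0)).mul hm
    have h2 := (h.trans h1).sub (hf (k + 1))
    have h3 : ∀ x : ℝ, (P.trunc (k + 1)).eval x = PowerSeries.coeff k P * x ^ k := fun x => by
      rw [PowerSeries.trunc_succ, Polynomial.eval_add]
      have : P.trunc k = 0 := by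
        ext j
        rw [PowerSeries.coeff_trunc]
        split_ifs with hj
        · simp [ih j hj (hj.trans hk)]
        · simp
      simp [this]
    simp only [sub_sub_cancel, h3] at h2
    by_contra hne
    have h4 := (h2.trans_isLittleO (isLittleO_pow_pow (k.lt_succ_self))).const_mul_left
      (PowerSeries.coeff k P)⁻¹
    simp only [← mul_assoc, inv_mul_cancel₀ hne, one_mul] at h4
    refine isLittleO_irrefl ?_ h4
    have h5 : ∃ᶠ x : ℝ in 𝓝[≠] 0, x ∈ ({0}ᶜ : Set ℝ) :=
      (eventually_mem_nhdsWithin).frequently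
    exact (h5.filter_mono nhdsWithin_le_nhds).mono fun x hx => pow_ne_zero k hx

theorem unique (hf : HasExpansion f P) (hg : HasExpansion f Q) : P = Q := by
  ext k
  have h : (fun x => f x - f x) =O[𝓝 0] fun x : ℝ => x ^ (k + 1) := by
    simpa using isBigO_zero _ _
  simpa [sub_eq_zero] using (hf.sub hg).coeff_eq_zero h k k.lt_succ_self

theorem isBigO_id (hf : HasExpansion f P) (h : PowerSeries.coeff 0 P = 0) :
    f =O[𝓝 0] fun x => x := by
  simpa [PowerSeries.trunc_one_left, h] using hf 1

end HasExpansion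

theorem eval_trunc (P : PowerSeries ℝ) (n : ℕ) (x : ℝ) :
    (P.trunc n).eval x = ∑ k ∈ Finset.range n, PowerSeries.coeff k P * x ^ k := by
  simpa [Polynomial.eval₂_eq_eval_map] using
    PowerSeries.eval₂_trunc_eq_sum_range x (RingHom.id ℝ) n P

theorem hasExpansion_of_hasFPowerSeriesAt {f : ℝ → ℝ} {q : FormalMultilinearSeries ℝ ℝ ℝ}
    (hf : HasFPowerSeriesAt f q 0) : HasExpansion f (PowerSeries.mk q.coeff) := fun n => by
  have h := hf.isBigO_sub_partialSum_pow n
  simp only [← norm_pow] at h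
  refine h.of_norm_right.congr_left fun x => ?_
  simp [eval_trunc, FormalMultilinearSeries.partialSum, mul_comm]

/-- By uniqueness, an expansion obtained by formal computation must be the Taylor series, so it
inherits convergence. -/
theorem HasExpansion.eventually_hasSum {f : ℝ → ℝ} {P : PowerSeries ℝ} (hf : HasExpansion f P)
    (ha : AnalyticAt ℝ f 0) :
    ∀ᶠ x in 𝓝 0, HasSum (fun n => PowerSeries.coeff n P * x ^ n) (f x) := by
  obtain ⟨q, hq⟩ := ha
  obtain rfl := hf.unique (hasExpansion_of_hasFPowerSeriesAt hq)
  filter_upwards [hq.eventually_hasSum] with x hx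
  simpa [mul_comm] using hx

theorem hasExpansion_of_eventually_hasSum {f : ℝ → ℝ} {P : PowerSeries ℝ}
    (h : ∀ᶠ x in 𝓝 0, HasSum (fun n => PowerSeries.coeff n P * x ^ n) (f x)) :
    HasExpansion f P := by
  have hq : HasFPowerSeriesAt f (.ofScalars ℝ fun n => PowerSeries.coeff n P) 0 := by
    rw [hasFPowerSeriesAt_iff]
    filter_upwards [h] with x hx
    simpa [mul_comm, FormalMultilinearSeries.coeff_ofScalars] using hx
  convert hasExpansion_of_hasFPowerSeriesAt hq using 1
  ext n
  simp [FormalMultilinearSeries.coeff_ofScalars]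

theorem ring_choose_three_halves (j : ℕ) : Ring.choose (3 / 2 : ℝ) j = binom j := by
  have h : ∀ m : ℕ, (descPochhammer ℤ m).smeval (3 / 2 : ℝ) =
      ∏ i ∈ Finset.range m, ((3 : ℝ) / 2 - i) := fun m => by
    induction m with
    | zero => simp
    | succ m ih =>
      rw [descPochhammer_succ_right, Polynomial.smeval_mul, ih, Finset.prod_range_succ]
      congr 1
      simp [Polynomial.smeval_natCast]
  rw [Ring.choose_eq_smul, h, binom, smul_eq_mul]
  exact (div_eq_inv_mul _ _).symm

/-- The expansion of `(1 - u) ^ (3 / 2)` for `u` with an expansion without constant term. -/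
theorem HasExpansion.coeff_one_sub_rpow {u f : ℝ → ℝ} {U F : PowerSeries ℝ}
    (hu : HasExpansion u U) (hU : PowerSeries.coeff 0 U = 0) (hu0 : u 0 = 0)
    (huc : ContinuousAt u 0)
    (hf : HasExpansion f F) (h : ∀ᶠ x in 𝓝 0, f x = (1 - u x) ^ (3 / 2 : ℝ)) (n : ℕ) :
    PowerSeries.coeff n F =
      ∑ j ∈ Finset.range (n + 1), binom j * PowerSeries.coeff n ((-U) ^ j) := by
  have h1 := (Real.one_add_rpow_hasFPowerSeriesAt_zero (a := 3 / 2)).isBigO_sub_partialSum_pow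
    (n + 1)
  have h2 : Tendsto (fun x => -u x) (𝓝 0) (𝓝 0) := by simpa [hu0] using huc.tendsto.neg
  simp only [← norm_pow] at h1
  -- Since `u = O(x)`, cutting the binomial series after the power `n` costs only `O(x ^ (n + 1))`.
  have h3 := (h1.of_norm_right.comp_tendsto h2).trans ((hu.isBigO_id hU).neg_left.pow (n + 1))
  have h4 := hf.sub (HasExpansion.sum (Finset.range (n + 1)) fun j =>
    ((hu.neg.pow j).const_mul (binom j)))
  have h5 := h4.coeff_eq_zero (n := n + 1) ?_ n n.lt_succ_self
  · simpa [sub_eq_zero] using h5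
  · refine h3.congr' ?_ EventuallyEq.rfl
    filter_upwards [h] with x hx
    simp [hx, FormalMultilinearSeries.partialSum, binomialSeries, ring_choose_three_halves,
      sub_eq_add_neg, mul_comm]

end NilpotentFocus

/-! ### The matching equation for formal power series -/

namespace NilpotentFocus

open Filter Topology Asymptotics

open PowerSeries in
/-- The coefficient of order `n + 1` of a series enters the one of its height through four times
itself. -/
theorem coeff_heightSq_succ (n : ℕ) (s : ℝ) {G T : PowerSeries ℝ} (hG : coeff 0 G = 1)
    (hT : coeff 0 T = 1) {W : PowerSeries ℝ} (h : G - T = X ^ (n + 1) * W) :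
    coeff (n + 1) (heightSq (n + 1) s G) =
      4 * coeff 0 W + coeff (n + 1) (heightSq (n + 1) s T) := by
  set S : PowerSeries ℝ → PowerSeries ℝ :=
    fun E => ∑ k ∈ Finset.Icc 1 (n + 1), c k • (s • (X * E ^ 3)) ^ k with hS
  -- Each term of `S` carries a factor `X`, so this difference vanishes one order further than `G -
  -- T`; order `n + 1` feels only `G ^ 4 - T ^ 4`.
  have h1 : (X : PowerSeries ℝ) ^ (n + 2) ∣ S T - S G := by
    rw [hS]
    simp only [← Finset.sum_sub_distrib, ← smul_sub]
    refine Finset.dvd_sum fun k _ => ?_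
    rw [smul_eq_C_mul]
    refine Dvd.dvd.mul_left ?_ _
    refine dvd_trans ?_ (sub_dvd_pow_sub_pow _ _ k)
    rw [← smul_sub, ← mul_sub, smul_eq_C_mul]
    refine Dvd.dvd.mul_left ?_ _
    rw [pow_succ']
    refine mul_dvd_mul_left _ (dvd_trans ?_ (sub_dvd_pow_sub_pow _ _ 3))
    exact (dvd_neg.2 (Dvd.intro _ h.symm)).trans (by simp)
  obtain ⟨D, hD⟩ := h1
  have h2 : heightSq (n + 1) s G = heightSq (n + 1) s T +
      X ^ (n + 1) * (W * ((G ^ 3 + G ^ 2 * T + G * T ^ 2 + T ^ 3) * (1 - S G)) +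
        X * (T ^ 4 * D)) := by
    have : X ^ (n + 1) * (W * ((G ^ 3 + G ^ 2 * T + G * T ^ 2 + T ^ 3) * (1 - S G)) +
        X * (T ^ 4 * D)) = (X ^ (n + 1) * W) * (G ^ 3 + G ^ 2 * T + G * T ^ 2 + T ^ 3) * (1 - S G)
          + T ^ 4 * (X ^ (n + 2) * D) := by ring
    rw [this, ← h, ← hD]
    simp only [heightSq, hS]
    ring
  have hS0 : coeff 0 (S G) = 0 := by
    rw [hS]
    simp only [map_sum]
    refine Finset.sum_eq_zero fun k hk => ?_
    have : k ≠ 0 := by have := (Finset.mem_Icc.1 hk).1; omega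
    simp [this, mul_pow, smul_pow]
  have h3 : coeff (n + 1) (X ^ (n + 1) * (W * ((G ^ 3 + G ^ 2 * T + G * T ^ 2 + T ^ 3) * (1 - S G))
      + X * (T ^ 4 * D))) = 4 * coeff 0 W := by
    have := coeff_X_pow_mul (W * ((G ^ 3 + G ^ 2 * T + G * T ^ 2 + T ^ 3) * (1 - S G))
      + X * (T ^ 4 * D)) (n + 1) 0
    rw [zero_add] at this
    rw [this]
    simp only [coeff_zero_eq_constantCoeff] at *
    simp only [map_add, map_mul, map_pow, map_sub, hG, hT, hS0, map_one, constantCoeff_X]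
    ring
  rw [h2, map_add, h3, add_comm]

theorem coeff_zero_mk_matchCoeff (E : PowerSeries ℝ) :
    PowerSeries.coeff 0 (PowerSeries.mk (matchCoeff E)) = 1 := by
  simp [matchCoeff]

/-- The matching equation characterizes the series computed by `matchCoeff`. -/
theorem eq_mk_matchCoeff {E G : PowerSeries ℝ} (hG : PowerSeries.coeff 0 G = 1)
    (h : ∀ n, PowerSeries.coeff n (heightSq n (-2) G) = PowerSeries.coeff n (heightSq n 2 E)) :
    G = PowerSeries.mk (matchCoeff E) := by
  ext n
  induction n using Nat.strong_induction_on with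
  | _ n ih =>
    match n with
    | 0 => rw [hG, coeff_zero_mk_matchCoeff]
    | n + 1 =>
      rw [PowerSeries.coeff_mk, matchCoeff]
      set T : PowerSeries ℝ := PowerSeries.mk fun k => if _h : k < n + 1 then matchCoeff E k else 0
        with hT
      have h1 : PowerSeries.X ^ (n + 1) ∣ G - T := by
        rw [PowerSeries.X_pow_dvd_iff]
        intro m hm
        rw [map_sub, ih m hm]
        simp [hT, Nat.lt_succ_iff.1 hm]
      obtain ⟨W, hW⟩ := h1
      have h2 : PowerSeries.coeff 0 W = PowerSeries.coeff (n + 1) G := by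
        have h3 := PowerSeries.coeff_X_pow_mul W (n + 1) 0
        rw [zero_add, ← hW, map_sub] at h3
        rw [← h3]
        simp [hT]
      have h4 := coeff_heightSq_succ n (-2) hG (T := T) (by simp [hT, matchCoeff]) hW
      rw [h, h2] at h4
      rw [map_sub, h4]
      ring

/-- The generating function of the numbers `c n`. -/
noncomputable def heightSeries : PowerSeries ℝ := PowerSeries.mk c

theorem c_zero : c 0 = 0 := by simp [c, v]

/-- The argument of `C` is `O(x)`, so a truncation at order `n` is harmless for the coefficient of
order `n`. This justifies the finite sum in `heightSq`. -/
theorem isBigO_height_sub {C e : ℝ → ℝ} {E : PowerSeries ℝ} (hC : HasExpansion C heightSeries)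
    (he : HasExpansion e E) (s : ℝ) (n : ℕ) :
    (fun x => e x ^ 4 * (1 - C (s * (x * e x ^ 3))) -
      e x ^ 4 * (1 - ∑ k ∈ Finset.Icc 1 n, c k * (s * (x * e x ^ 3)) ^ k)) =O[𝓝 0]
        fun x => x ^ (n + 1) := by
  have h1 : (fun x => s * (x * e x ^ 3)) =O[𝓝 0] fun x => x := by
    have := ((isBigO_refl (fun x : ℝ => x) (𝓝 0)).mul (he.pow 3).isBigO_one).const_mul_left s
    simpa using this
  have h2 : Tendsto (fun x => s * (x * e x ^ 3)) (𝓝 0) (𝓝 0) := h1.trans_tendsto tendsto_id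
  have h3 := ((hC (n + 1)).comp_tendsto h2).trans (h1.pow (n + 1))
  have h4 := ((he.pow 4).isBigO_one.mul h3).neg_left
  simp only [one_mul] at h4
  refine h4.congr_left fun x => ?_
  simp only [Function.comp, eval_trunc, heightSeries, PowerSeries.coeff_mk]
  rw [Finset.range_eq_Ico, Finset.sum_eq_sum_Ico_succ_bot (by omega), c_zero,
    show Finset.Ico (0 + 1) (n + 1) = Finset.Icc 1 n by ext; simp]
  ring

theorem hasExpansion_heightSq {e : ℝ → ℝ} {E : PowerSeries ℝ} (he : HasExpansion e E)
    (s : ℝ) (n : ℕ) :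
    HasExpansion (fun x => e x ^ 4 * (1 - ∑ k ∈ Finset.Icc 1 n, c k * (s * (x * e x ^ 3)) ^ k))
      (heightSq n s E) :=
  (he.pow 4).mul (HasExpansion.one.sub (HasExpansion.sum _ fun k =>
    (((HasExpansion.id.mul (he.pow 3)).const_mul s).pow k).const_mul (c k)))

/-- Functions that satisfy the matching equation have the series computed by `matchCoeff`. -/
theorem hasExpansion_matchCoeff {C e g : ℝ → ℝ} {E G : PowerSeries ℝ}
    (hC : HasExpansion C heightSeries) (he : HasExpansion e E) (hg : HasExpansion g G)
    (hG : PowerSeries.coeff 0 G = 1)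
    (h : ∀ᶠ x in 𝓝 0, g x ^ 4 * (1 - C (-2 * (x * g x ^ 3))) =
      e x ^ 4 * (1 - C (2 * (x * e x ^ 3)))) :
    HasExpansion g (PowerSeries.mk (matchCoeff E)) := by
  rw [← eq_mk_matchCoeff hG (E := E)]
  · exact hg
  intro n
  have h1 := (hasExpansion_heightSq hg (-2) n).sub (hasExpansion_heightSq he 2 n)
  have h2 := (isBigO_height_sub hC he 2 n).sub (isBigO_height_sub hC hg (-2) n)
  have h3 := h1.coeff_eq_zero (n := n + 1) (h2.congr' ?_ EventuallyEq.rfl) n n.lt_succ_self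
  · simpa [sub_eq_zero] using h3
  · filter_upwards [h] with x hx
    rw [hx]
    ring

end NilpotentFocus

/-! ### Explicit first coefficients and first iterated integrals -/

namespace NilpotentFocus

section

open PowerSeries

theorem coeff_one_mul' (P Q : PowerSeries ℝ) :
    coeff 1 (P * Q) = coeff 0 P * coeff 1 Q + coeff 1 P * coeff 0 Q := by
  simp [coeff_mul, Finset.Nat.antidiagonal_succ]

theorem coeff_two_mul (P Q : PowerSeries ℝ) :
    coeff 2 (P * Q) = coeff 0 P * coeff 2 Q + coeff 1 P * coeff 1 Q + coeff 2 P * coeff 0 Q := by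
  simp [coeff_mul, Finset.Nat.antidiagonal_succ]
  ring

theorem coeff_three_mul (P Q : PowerSeries ℝ) :
    coeff 3 (P * Q) = coeff 0 P * coeff 3 Q + coeff 1 P * coeff 2 Q + coeff 2 P * coeff 1 Q +
      coeff 3 P * coeff 0 Q := by
  simp [coeff_mul, Finset.Nat.antidiagonal_succ]
  ring

theorem coeff_zero_pow' {G : PowerSeries ℝ} (hG : coeff 0 G = 1) (m : ℕ) :
    coeff 0 (G ^ m) = 1 := by
  rw [coeff_zero_eq_constantCoeff] at *
  simp [hG]

theorem coeff_one_pow' {G : PowerSeries ℝ} (hG : coeff 0 G = 1) (m : ℕ) :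
    coeff 1 (G ^ m) = m * coeff 1 G := by
  induction m with
  | zero => simp [coeff_one]
  | succ m ih =>
    rw [pow_succ, coeff_one_mul', ih, coeff_zero_pow' hG, hG]
    push_cast
    ring

theorem coeff_two_pow' {G : PowerSeries ℝ} (hG : coeff 0 G = 1) (m : ℕ) :
    coeff 2 (G ^ m) = m * coeff 2 G + m * (m - 1) / 2 * coeff 1 G ^ 2 := by
  induction m with
  | zero => simp [coeff_one]
  | succ m ih =>
    rw [pow_succ, coeff_two_mul, ih, coeff_one_pow' hG, coeff_zero_pow' hG, hG]
    push_cast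
    ring

theorem coeff_three_pow' {G : PowerSeries ℝ} (hG : coeff 0 G = 1) (m : ℕ) :
    coeff 3 (G ^ m) = m * coeff 3 G + m * (m - 1) * coeff 1 G * coeff 2 G +
      m * (m - 1) * (m - 2) / 6 * coeff 1 G ^ 3 := by
  induction m with
  | zero => simp [coeff_one]
  | succ m ih =>
    rw [pow_succ, coeff_three_mul, ih, coeff_two_pow' hG, coeff_one_pow' hG, coeff_zero_pow' hG, hG]
    push_cast
    ring

theorem heightSq_eq_sum (n : ℕ) (s : ℝ) (E : PowerSeries ℝ) :
    heightSq n s E = E ^ 4 - ∑ k ∈ Finset.Icc 1 n, (c k * s ^ k) • (X ^ k * E ^ (3 * k + 4)) := by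
  rw [heightSq, mul_sub, mul_one, Finset.mul_sum]
  congr 1
  refine Finset.sum_congr rfl fun k _ => ?_
  simp only [mul_pow, smul_eq_C_mul, map_mul, map_pow]
  ring

theorem coeff_one_heightSq (s : ℝ) {G : PowerSeries ℝ} (hG : coeff 0 G = 1) :
    coeff 1 (heightSq 1 s G) = 4 * coeff 1 G - s * c 1 := by
  have h1 := coeff_X_pow_mul (G ^ 7) 1 0
  simp only [zero_add, pow_one, coeff_zero_pow' hG] at h1
  rw [heightSq_eq_sum]
  simp only [Finset.Icc_self, Finset.sum_singleton, map_sub, map_smul, smul_eq_mul, pow_one,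
    coeff_one_pow' hG, h1, Nat.reduceMul, Nat.reduceAdd]
  push_cast
  ring

theorem coeff_two_heightSq (s : ℝ) {G : PowerSeries ℝ} (hG : coeff 0 G = 1) :
    coeff 2 (heightSq 2 s G) = 4 * coeff 2 G + 6 * coeff 1 G ^ 2 - 7 * s * c 1 * coeff 1 G -
      s ^ 2 * c 2 := by
  have h1 := coeff_X_pow_mul (G ^ 7) 1 1
  have h2 := coeff_X_pow_mul (G ^ 10) 2 0
  simp only [zero_add, coeff_zero_pow' hG, coeff_one_pow' hG, pow_one, Nat.reduceAdd] at h1 h2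
  simp [-coeff_succ_X_mul, heightSq_eq_sum, Finset.sum_Icc_succ_top, coeff_two_pow' hG, h1, h2]
  ring

theorem coeff_three_heightSq (s : ℝ) {G : PowerSeries ℝ} (hG : coeff 0 G = 1) :
    coeff 3 (heightSq 3 s G) = 4 * coeff 3 G + 12 * coeff 1 G * coeff 2 G + 4 * coeff 1 G ^ 3 -
      s * c 1 * (7 * coeff 2 G + 21 * coeff 1 G ^ 2) - 10 * s ^ 2 * c 2 * coeff 1 G -
      s ^ 3 * c 3 := by
  have h1 := coeff_X_pow_mul (G ^ 7) 1 2
  have h2 := coeff_X_pow_mul (G ^ 10) 2 1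
  have h3 := coeff_X_pow_mul (G ^ 13) 3 0
  simp only [zero_add, coeff_zero_pow' hG, coeff_one_pow' hG, coeff_two_pow' hG, pow_one,
    Nat.reduceAdd] at h1 h2 h3
  simp [heightSq_eq_sum, Finset.sum_Icc_succ_top, coeff_two_pow' hG, coeff_three_pow' hG,
    h2, h3]
  ring

/-- The series computed by `matchCoeff` satisfies the matching equation. -/
theorem coeff_heightSq_matchCoeff (E : PowerSeries ℝ) (n : ℕ) :
    coeff (n + 1) (heightSq (n + 1) (-2) (mk (matchCoeff E))) =
      coeff (n + 1) (heightSq (n + 1) 2 E) := by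
  set T : PowerSeries ℝ := mk fun k => if _h : k < n + 1 then matchCoeff E k else 0 with hT
  have h1 : X ^ (n + 1) ∣ mk (matchCoeff E) - T := by
    rw [X_pow_dvd_iff]
    intro m hm
    simp [hT, Nat.lt_succ_iff.1 hm]
  obtain ⟨W, hW⟩ := h1
  have h2 : coeff 0 W = matchCoeff E (n + 1) := by
    have h3 := coeff_X_pow_mul W (n + 1) 0
    rw [zero_add, ← hW, map_sub] at h3
    rw [← h3]
    simp [hT]
  rw [coeff_heightSq_succ n (-2) (coeff_zero_mk_matchCoeff E) (T := T)
    (by simp [hT, matchCoeff]) hW, h2, matchCoeff, map_sub]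
  ring

theorem coeff_one_halfTurn : coeff 1 halfTurn = -c 1 := by
  have h := coeff_heightSq_matchCoeff 1 0
  rw [zero_add, coeff_one_heightSq _ (coeff_zero_mk_matchCoeff 1), coeff_one_heightSq _ (by simp)]
    at h
  rw [halfTurn]
  simp only [coeff_one] at h
  norm_num at h ⊢
  linarith

theorem coeff_two_halfTurn : coeff 2 halfTurn = 2 * c 1 ^ 2 := by
  have h := coeff_heightSq_matchCoeff 1 1
  have h1 := coeff_one_halfTurn
  rw [halfTurn] at h1 ⊢
  rw [coeff_two_heightSq _ (coeff_zero_mk_matchCoeff 1), coeff_two_heightSq _ (by simp), h1] at h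
  simp only [coeff_one] at h
  norm_num at h ⊢
  linarith

theorem coeff_three_halfTurn :
    coeff 3 halfTurn = -(21 / 2) * c 1 ^ 3 - 10 * c 1 * c 2 - 4 * c 3 := by
  have h := coeff_heightSq_matchCoeff 1 2
  have h1 := coeff_one_halfTurn
  have h2 := coeff_two_halfTurn
  rw [halfTurn] at h1 h2 ⊢
  rw [coeff_three_heightSq _ (coeff_zero_mk_matchCoeff 1), coeff_three_heightSq _ (by simp), h1,
    h2] at h
  simp only [coeff_one] at h
  norm_num at h ⊢
  linarith

theorem coeff_zero_halfTurn : coeff 0 halfTurn = 1 := coeff_zero_mk_matchCoeff 1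

theorem coeff_one_fullTurn : coeff 1 fullTurn = -2 * c 1 := by
  have h := coeff_heightSq_matchCoeff halfTurn 0
  rw [zero_add, coeff_one_heightSq _ (coeff_zero_mk_matchCoeff _),
    coeff_one_heightSq _ coeff_zero_halfTurn, coeff_one_halfTurn] at h
  rw [fullTurn]
  linarith

theorem coeff_two_fullTurn : coeff 2 fullTurn = 8 * c 1 ^ 2 := by
  have h := coeff_heightSq_matchCoeff halfTurn 1
  have h1 := coeff_one_fullTurn
  rw [fullTurn] at h1 ⊢
  rw [coeff_two_heightSq _ (coeff_zero_mk_matchCoeff _), coeff_two_heightSq _ coeff_zero_halfTurn,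
    coeff_one_halfTurn, coeff_two_halfTurn, h1] at h
  linarith

theorem coeff_three_fullTurn :
    coeff 3 fullTurn = -49 * c 1 ^ 3 - 20 * c 1 * c 2 - 8 * c 3 := by
  have h := coeff_heightSq_matchCoeff halfTurn 2
  have h1 := coeff_one_fullTurn
  have h2 := coeff_two_fullTurn
  rw [fullTurn] at h1 h2 ⊢
  rw [coeff_three_heightSq _ (coeff_zero_mk_matchCoeff _),
    coeff_three_heightSq _ coeff_zero_halfTurn,
    coeff_one_halfTurn, coeff_two_halfTurn, coeff_three_halfTurn, h1, h2] at h
  linarith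

theorem two_rpow_three_halves : (2 : ℝ) ^ (3 / 2 : ℝ) = 2 * Real.sqrt 2 := by
  rw [show (3 / 2 : ℝ) = 1 + 1 / 2 by norm_num, Real.rpow_add two_pos, Real.rpow_one,
    Real.sqrt_eq_rpow]

theorem returnCoeff_one : returnCoeff 1 = -(2 : ℝ) ^ (3 / 2 : ℝ) * c 1 := by
  rw [returnCoeff, coeff_one_fullTurn, two_rpow_three_halves]
  ring

theorem returnCoeff_two : returnCoeff 2 = 16 * c 1 ^ 2 := by
  rw [returnCoeff, coeff_two_fullTurn, Real.sq_sqrt two_pos.le]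
  ring

theorem returnCoeff_three : returnCoeff 3 = -(2 : ℝ) ^ (3 / 2 : ℝ) *
    (20 * c 2 * c 1 + 8 * c 3 + 49 * c 1 ^ 3) := by
  rw [returnCoeff, coeff_three_fullTurn, two_rpow_three_halves, pow_succ, Real.sq_sqrt two_pos.le]
  ring

end

/-- Together with `|V| ≤ 1 / 2` this keeps `p - V` positive, so that the power `3 / 2` stays in its
smooth range. -/
theorem one_le_p {t : ℝ} (ht : t ∈ Icc (0 : ℝ) 1) : 1 ≤ p t := by
  have h : t ^ 2 ≤ 1 := pow_le_one₀ ht.1 ht.2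
  have : p t - 1 = (1 - t ^ 2) * ((t ^ 2 - 3 / 2) ^ 2 + 3 / 4) := by unfold p; ring
  have h2 : 0 ≤ (1 - t ^ 2) * ((t ^ 2 - 3 / 2) ^ 2 + 3 / 4) :=
    mul_nonneg (by linarith) (by positivity)
  linarith

/-- Two series that agree modulo `X ^ (n + 1)` have powers that agree modulo `X ^ (n + 1)`. This
removes the cut-off that the recursion defining `v` needs for termination. -/
theorem R_congr {n : ℕ} {a b : ℕ → ℝ} (h : ∀ k, k ≠ 0 → k ≤ n → a k = b k) : R n a = R n b := by
  refine Finset.sum_congr rfl fun j _ => ?_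
  congr 1
  set A : PowerSeries ℝ := -(PowerSeries.mk fun k => if k = 0 then 0 else a k)
  set B : PowerSeries ℝ := -(PowerSeries.mk fun k => if k = 0 then 0 else b k)
  have hd : (PowerSeries.X : PowerSeries ℝ) ^ (n + 1) ∣ A - B := by
    rw [PowerSeries.X_pow_dvd_iff]
    intro m hm
    by_cases h0 : m = 0
    · simp [A, B, h0]
    · simp [A, B, h0, h m h0 (Nat.lt_succ_iff.1 hm)]
  have := PowerSeries.X_pow_dvd_iff.1 (hd.trans (sub_dvd_pow_sub_pow A B j)) n n.lt_succ_self
  simpa [sub_eq_zero] using this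

theorem R_zero (a : ℕ → ℝ) : R 0 a = 1 := by simp [R, binom]

theorem R_one (a : ℕ → ℝ) : R 1 a = -(3 / 2) * a 1 := by
  simp [R, binom, Finset.sum_range_succ, PowerSeries.coeff_one]

theorem R_two (a : ℕ → ℝ) : R 2 a = -(3 / 2) * a 2 + 3 / 8 * a 1 ^ 2 := by
  simp [R, binom, Finset.sum_range_succ, Finset.prod_range_succ, PowerSeries.coeff_one,
    coeff_two_mul, pow_two]
  left
  ring

theorem v_succ (n : ℕ) (ξ : ℝ) : v (n + 1) ξ = (ξ ^ 2)⁻¹ * ∫ t in (0 : ℝ)..ξ,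
    t ^ 4 * p t ^ (3 / 2 : ℝ) * R n fun k => v k t / p t := by
  rw [v]
  beta_reduce
  congr 1
  apply intervalIntegral.integral_congr
  intro t _
  simp only
  congr 1
  exact R_congr fun k _ hk => by simp [Nat.lt_succ_iff.2 hk]

theorem v_one_eq (ξ : ℝ) :
    v 1 ξ = (ξ ^ 2)⁻¹ * ∫ t in (0 : ℝ)..ξ, t ^ 4 * p t ^ (3 / 2 : ℝ) := by
  simp [v_succ, R_zero]

theorem mem_Icc_of_mem_uIcc {ξ t : ℝ} (hξ : ξ ∈ Icc (0 : ℝ) 1) (ht : t ∈ uIcc 0 ξ) :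
    t ∈ Icc (0 : ℝ) 1 := by
  rw [uIcc_of_le hξ.1] at ht
  exact ⟨ht.1, ht.2.trans hξ.2⟩

theorem p_rpow {t : ℝ} (ht : t ∈ Icc (0 : ℝ) 1) :
    p t ^ (3 / 2 : ℝ) = p t * p t ^ (1 / 2 : ℝ) := by
  have := one_le_p ht
  rw [show (3 / 2 : ℝ) = 1 + 1 / 2 by norm_num, Real.rpow_add (by linarith), Real.rpow_one]

theorem v_two_eq {ξ : ℝ} (hξ : ξ ∈ Icc (0 : ℝ) 1) :
    v 2 ξ = -(3 / 2) * (ξ ^ 2)⁻¹ * ∫ t in (0 : ℝ)..ξ, t ^ 4 * p t ^ (1 / 2 : ℝ) * v 1 t := by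
  rw [v_succ, mul_comm (-(3 / 2) : ℝ), mul_assoc]
  congr 1
  rw [← intervalIntegral.integral_const_mul]
  apply intervalIntegral.integral_congr
  intro t ht
  have ht' := mem_Icc_of_mem_uIcc hξ ht
  have hp := one_le_p ht'
  have hp0 : p t ≠ 0 := by positivity
  simp only [R_one, p_rpow ht']
  field_simp

theorem v_three_eq {ξ : ℝ} (hξ : ξ ∈ Icc (0 : ℝ) 1) :
    v 3 ξ = (ξ ^ 2)⁻¹ * ∫ t in (0 : ℝ)..ξ, t ^ 4 *
      (-(3 / 2) * p t ^ (1 / 2 : ℝ) * v 2 t + (3 / 8) * (v 1 t ^ 2 / p t ^ (1 / 2 : ℝ))) := by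
  rw [v_succ]
  congr 1
  apply intervalIntegral.integral_congr
  intro t ht
  have ht' := mem_Icc_of_mem_uIcc hξ ht
  have hp := one_le_p ht'
  have hp0 : 0 < p t := by linarith
  have hs : 0 < p t ^ (1 / 2 : ℝ) := Real.rpow_pos_of_pos hp0 _
  have hs2 : p t ^ (1 / 2 : ℝ) * p t ^ (1 / 2 : ℝ) = p t := by
    rw [← Real.rpow_add hp0]; norm_num
  simp only [R_two, p_rpow ht']
  set q := p t ^ (1 / 2 : ℝ)
  rw [← hs2]
  field_simp

end NilpotentFocus

/-! ### Analytic dependence of the arc profiles on the parameter -/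

namespace NilpotentFocus

open Filter Topology Asymptotics ContDiff

/-- The real Banach algebra of continuous functions on `[0, 1]`. -/
abbrev Profile : Type := C(Icc (0 : ℝ) 1, ℝ)

/-- The extension of a continuous function on `[0, 1]` to the line, by constants. -/
noncomputable def Profile.extend (f : Profile) : ℝ → ℝ := IccExtend zero_le_one f

theorem Profile.continuous_extend (f : Profile) : Continuous f.extend := f.continuous.Icc_extend'

theorem Profile.extend_apply (f : Profile) {t : ℝ} (ht : t ∈ Icc (0 : ℝ) 1) :
    f.extend t = f ⟨t, ht⟩ := IccExtend_of_mem _ _ ht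

theorem Profile.abs_extend_le (f : Profile) (t : ℝ) : |f.extend t| ≤ ‖f‖ :=
  f.norm_coe_le_norm _

/-- The operator `f ↦ ξ⁻² ∫₀^ξ t ^ 4 f(t) dt`. -/
noncomputable def averaging : Profile →L[ℝ] Profile :=
  LinearMap.mkContinuous
    -- The substitution `t = ξ * s` absorbs the singular factor `ξ⁻²`, which makes continuity at `ξ
    -- = 0` and the norm bound evident.
    { toFun := fun f => ⟨fun ξ => (ξ : ℝ) ^ 3 * ∫ s in (0 : ℝ)..1, s ^ 4 * f.extend (ξ * s), by
        have h : Continuous fun x : ℝ => ∫ s in (0 : ℝ)..1, s ^ 4 * f.extend (x * s) := by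
          apply intervalIntegral.continuous_parametric_intervalIntegral_of_continuous'
          exact (continuous_snd.pow 4).mul
            (f.continuous_extend.comp (continuous_fst.mul continuous_snd))
        exact (continuous_subtype_val.pow 3).mul (h.comp continuous_subtype_val)⟩
      map_add' := fun f g => by
        ext ξ
        have hf : ∀ f : Profile, IntervalIntegrable (fun s => s ^ 4 * f.extend (ξ * s))
            MeasureTheory.volume 0 1 := fun f =>
          ((continuous_pow 4).mul (f.continuous_extend.comp
            (continuous_const.mul continuous_id))).intervalIntegrable _ _
        simp only [ContinuousMap.coe_mk, ContinuousMap.add_apply]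
        rw [← mul_add, ← intervalIntegral.integral_add (hf f) (hf g)]
        congr 2
        ext s
        simp only [Profile.extend, IccExtend, Function.comp, ContinuousMap.add_apply]
        ring
      map_smul' := fun a f => by
        ext ξ
        simp only [ContinuousMap.coe_mk, ContinuousMap.smul_apply, smul_eq_mul, RingHom.id_apply]
        rw [mul_left_comm, ← intervalIntegral.integral_const_mul a]
        congr 1
        apply intervalIntegral.integral_congr
        intro s _
        simp only [Profile.extend, IccExtend, Function.comp, ContinuousMap.smul_apply, smul_eq_mul]
        ring } 1 fun f => by
    rw [one_mul, ContinuousMap.norm_le _ (norm_nonneg f)]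
    intro ξ
    have hξ : |(ξ : ℝ) ^ 3| ≤ 1 := by
      rw [abs_of_nonneg (pow_nonneg ξ.2.1 3)]
      exact pow_le_one₀ ξ.2.1 ξ.2.2
    have h := intervalIntegral.norm_integral_le_of_norm_le_const (a := 0) (b := 1) (C := ‖f‖)
      (f := fun s => s ^ 4 * f.extend (ξ * s)) fun s hs => by
        rw [uIoc_of_le zero_le_one] at hs
        rw [norm_mul, norm_pow, Real.norm_eq_abs, abs_of_pos hs.1]
        exact (mul_le_mul (pow_le_one₀ hs.1.le hs.2) (f.abs_extend_le _)
          (abs_nonneg _) zero_le_one).trans_eq (one_mul _)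
    simp only [sub_zero, abs_one, mul_one] at h
    simp only [LinearMap.coe_mk, AddHom.coe_mk, ContinuousMap.coe_mk, norm_mul]
    exact (mul_le_mul hξ h (norm_nonneg _) zero_le_one).trans_eq (one_mul _)

theorem averaging_apply (f : Profile) (ξ : Icc (0 : ℝ) 1) :
    averaging f ξ = (ξ : ℝ) ^ 3 * ∫ s in (0 : ℝ)..1, s ^ 4 * f.extend (ξ * s) := rfl

theorem sq_mul_averaging (f : Profile) (ξ : Icc (0 : ℝ) 1) :
    (ξ : ℝ) ^ 2 * averaging f ξ = ∫ t in (0 : ℝ)..ξ, t ^ 4 * f.extend t := by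
  have h := intervalIntegral.mul_integral_comp_mul_left (a := 0) (b := 1)
    (f := fun t => t ^ 4 * f.extend t) (ξ : ℝ)
  simp only [mul_zero, mul_one] at h
  rw [← h, averaging_apply]
  simp only [mul_pow, mul_assoc, intervalIntegral.integral_const_mul]
  ring

/-- The polynomial `p` as a function on `[0, 1]`. -/
noncomputable def pMap : Profile := ⟨fun t => p t, by unfold p; fun_prop⟩

/-- The function `1 / p` on `[0, 1]`. -/
noncomputable def pInvMap : Profile :=
  ⟨fun t => (p t)⁻¹, (pMap.continuous).inv₀ fun t => by
    have := one_le_p t.2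
    change p t ≠ 0
    positivity⟩

/-- The function `p ^ (3 / 2)` on `[0, 1]`. -/
noncomputable def pPowMap : Profile :=
  ⟨fun t => p t ^ (3 / 2 : ℝ), (pMap.continuous).rpow_const fun _ => Or.inr (by norm_num)⟩

theorem pInvMap_apply (t : Icc (0 : ℝ) 1) : pInvMap t = (p t)⁻¹ := rfl

theorem pPowMap_apply (t : Icc (0 : ℝ) 1) : pPowMap t = p t ^ (3 / 2 : ℝ) := rfl

/-- The sum of the binomial series of exponent `3 / 2`. -/
noncomputable def binomialSum (u : Profile) : Profile :=
  (binomialSeries Profile (3 / 2 : ℝ)).sum u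

theorem binomialSeries_profile_radius_pos :
    0 < (binomialSeries Profile (3 / 2 : ℝ)).radius := by
  have h1 := Real.one_add_rpow_hasFPowerSeriesAt_zero (a := 3 / 2)
  have h2 : (binomialSeries ℝ (3 / 2 : ℝ)).radius ≤ (binomialSeries Profile (3 / 2 : ℝ)).radius :=
    FormalMultilinearSeries.radius_le_of_le fun n => by
      simp [binomialSeries]
  exact h1.radius_pos.trans_le h2

theorem analyticAt_binomialSum : AnalyticAt ℝ binomialSum 0 :=
  ⟨_, (FormalMultilinearSeries.hasFPowerSeriesOnBall _
    binomialSeries_profile_radius_pos).hasFPowerSeriesAt⟩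

/-- Evaluation at a point is a continuous algebra homomorphism, so it carries the series in the
Banach algebra to the real binomial series, which converges on the unit ball. -/
theorem eventually_binomialSum_apply :
    ∀ᶠ u in 𝓝 (0 : Profile), ∀ t, binomialSum u t = (1 + u t) ^ (3 / 2 : ℝ) := by
  have h1 := (FormalMultilinearSeries.hasFPowerSeriesOnBall _
    binomialSeries_profile_radius_pos).hasFPowerSeriesAt.eventually_hasSum
  filter_upwards [h1, Metric.ball_mem_nhds (0 : Profile) one_pos] with u hu hu1 t
  have h2 := (ContinuousMap.evalCLM ℝ t).hasSum hu
  have h3 : ‖u t‖ < 1 := (u.norm_coe_le_norm t).trans_lt (by simpa using hu1)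
  have h4 := (Real.one_add_rpow_hasFPowerSeriesOnBall_zero (a := 3 / 2)).hasSum (y := u t)
    (by simpa [enorm_eq_nnnorm, ← NNReal.coe_lt_coe] using h3)
  simp only [zero_add] at h2 h4
  have h5 : (fun n => ContinuousMap.evalCLM ℝ t ((binomialSeries Profile (3 / 2 : ℝ) n) fun _ => u))
      = fun n => (binomialSeries ℝ (3 / 2 : ℝ) n) fun _ => u t := by
    funext n
    simp [binomialSeries, FormalMultilinearSeries.ofScalars_apply_eq, mul_comm]
  rw [h5] at h2
  exact h2.unique h4

/-- The map whose zeros are the profiles of the arcs with parameter `δ`. -/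
noncomputable def profileDefect (w : ℝ × Profile) : Profile :=
  w.2 - w.1 • averaging (pPowMap * binomialSum (-(pInvMap * w.2)))

theorem analyticAt_profileDefect : AnalyticAt ℝ profileDefect (0, 0) := by
  have h1 : AnalyticAt ℝ (fun w : ℝ × Profile => -(pInvMap * w.2)) (0, 0) :=
    (analyticAt_const.mul analyticAt_snd).neg
  have h2 : AnalyticAt ℝ (fun w : ℝ × Profile => binomialSum (-(pInvMap * w.2))) (0, 0) :=
    AnalyticAt.fun_comp (by simpa using analyticAt_binomialSum) h1
  have h3 : AnalyticAt ℝ (fun w : ℝ × Profile =>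
      averaging (pPowMap * binomialSum (-(pInvMap * w.2)))) (0, 0) :=
    AnalyticAt.fun_comp (averaging.analyticAt _) (analyticAt_const.mul h2)
  exact analyticAt_snd.sub (analyticAt_fst.smul h3)

/-- At `δ = 0` the integral term drops out and the defect is the identity in the profile. -/
theorem fderiv_profileDefect_comp_inr :
    fderiv ℝ profileDefect (0, 0) ∘L .inr ℝ ℝ Profile = .id ℝ Profile := by
  have h1 : HasFDerivAt (fun u : Profile => ((0 : ℝ), u)) (.inr ℝ ℝ Profile) 0 :=
    (ContinuousLinearMap.inr ℝ ℝ Profile).hasFDerivAt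
  have h2 := analyticAt_profileDefect.differentiableAt.hasFDerivAt.comp (0 : Profile) h1
  have h3 : profileDefect ∘ (fun u : Profile => ((0 : ℝ), u)) = id := by
    funext u
    simp [profileDefect]
  rw [h3] at h2
  exact h2.unique (hasFDerivAt_id 0)

theorem exists_analytic_profile : ∃ γ : ℝ → Profile, AnalyticAt ℝ γ 0 ∧ γ 0 = 0 ∧
    ∀ᶠ δ in 𝓝 0, γ δ = δ • averaging (pPowMap * binomialSum (-(pInvMap * γ δ))) := by
  have hc : ContDiffAt ℝ ω profileDefect (0, 0) := analyticAt_profileDefect.contDiffAt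
  have hi : (fderiv ℝ profileDefect (0, 0) ∘L .inr ℝ ℝ Profile).IsInvertible := by
    rw [fderiv_profileDefect_comp_inr]
    exact ⟨.refl ℝ Profile, rfl⟩
  have hω : (ω : WithTop ℕ∞) ≠ 0 := by simp
  refine ⟨hc.implicitFunction hω hi, (hc.contDiffAt_implicitFunction hω hi).analyticAt,
    hc.implicitFunction_apply_self hω hi, ?_⟩
  filter_upwards [hc.eventually_apply_implicitFunction hω hi] with δ hδ
  simpa [profileDefect, sub_eq_zero] using hδ

theorem hasExpansion_clm {γ : ℝ → Profile} {G : FormalMultilinearSeries ℝ ℝ Profile}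
    (hG : HasFPowerSeriesAt γ G 0) (φ : Profile →L[ℝ] ℝ) :
    HasExpansion (fun δ => φ (γ δ)) (PowerSeries.mk fun n => φ (G.coeff n)) := by
  apply hasExpansion_of_eventually_hasSum
  filter_upwards [hG.eventually_hasSum] with δ hδ
  have := φ.hasSum hδ
  simpa [mul_comm] using this

/-- The factor `δ` in the fixed-point equation shifts the order by one: the coefficient of order `m
+ 1` of `γ` is the average of `p ^ (3 / 2)` times the coefficient of order `m` of `(1 - γ / p) ^ (3
/ 2)`. The latter is `R m` of the earlier coefficients, which is the recursion for `v`. Everything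
is checked pointwise, by applying evaluation functionals. -/
theorem v_eq_coeff {γ : ℝ → Profile} {G : FormalMultilinearSeries ℝ ℝ Profile}
    (hG : HasFPowerSeriesAt γ G 0) (h0 : γ 0 = 0)
    (h : ∀ᶠ δ in 𝓝 0, γ δ = δ • averaging (pPowMap * binomialSum (-(pInvMap * γ δ))))
    (n : ℕ) (ξ : Icc (0 : ℝ) 1) : G.coeff n ξ = v n ξ := by
  set σ : ℝ → Profile := fun δ => binomialSum (-(pInvMap * γ δ)) with hσ
  have hγ : AnalyticAt ℝ γ 0 := hG.analyticAt
  have hσa : AnalyticAt ℝ σ 0 := by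
    refine AnalyticAt.fun_comp ?_ (analyticAt_const.mul hγ).neg
    simpa [h0] using analyticAt_binomialSum
  obtain ⟨S, hS⟩ := hσa
  have hG0 : G.coeff 0 = 0 := (hG.coeff_zero 1).trans h0
  have hrec : ∀ m (ζ : Icc (0 : ℝ) 1),
      G.coeff (m + 1) ζ = averaging (pPowMap * S.coeff m) ζ := fun m ζ => by
    have e1 := hasExpansion_clm hG (ContinuousMap.evalCLM ℝ ζ)
    have e2 := hasExpansion_clm hS (ContinuousMap.evalCLM ℝ ζ ∘L averaging ∘L
      ContinuousLinearMap.mul ℝ Profile pPowMap)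
    have e3 := (HasExpansion.id.mul e2).congr (g := fun δ => ContinuousMap.evalCLM ℝ ζ (γ δ)) (by
      filter_upwards [h] with δ hδ
      conv_rhs => rw [hδ]
      simp [hσ])
    have e4 := congrArg (PowerSeries.coeff (m + 1)) (e1.unique e3)
    simpa [PowerSeries.coeff_succ_X_mul] using e4
  have hcoef : ∀ m (ζ : Icc (0 : ℝ) 1),
      S.coeff m ζ = R m fun k => G.coeff k ζ / p ζ := fun m ζ => by
    have e1 := (hasExpansion_clm hG (ContinuousMap.evalCLM ℝ ζ)).const_mul (p ζ)⁻¹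
    have e2 := hasExpansion_clm hS (ContinuousMap.evalCLM ℝ ζ)
    have hc : Tendsto (fun δ => -(pInvMap * γ δ)) (𝓝 0) (𝓝 0) := by
      simpa [h0] using (continuousAt_const.mul hγ.continuousAt).neg.tendsto (f := fun δ =>
        -(pInvMap * γ δ))
    have e3 := e1.coeff_one_sub_rpow (by simp [hG0]) (by simp [h0])
      (continuousAt_const.mul ((ContinuousMap.evalCLM ℝ ζ).continuous.continuousAt.comp
        hγ.continuousAt)) e2 (by
        filter_upwards [hc.eventually eventually_binomialSum_apply] with δ hδ
        rw [ContinuousMap.evalCLM_apply, ContinuousMap.evalCLM_apply, hσ, hδ ζ,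
          ContinuousMap.neg_apply, ContinuousMap.mul_apply, pInvMap_apply, ← sub_eq_add_neg]) m
    simp only [PowerSeries.coeff_mk] at e3
    simp only [ContinuousMap.evalCLM_apply] at e3
    rw [e3, R]
    refine Finset.sum_congr rfl fun j _ => ?_
    congr 4
    ext k
    by_cases hk : k = 0
    · simp [hk, hG0]
    · simp [hk, div_eq_inv_mul]
  induction n using Nat.strong_induction_on generalizing ξ with
  | _ n ih =>
    match n with
    | 0 => simp [hG0, v]
    | n + 1 =>
      rw [hrec, v_succ]
      have h2 : ∫ t in (0 : ℝ)..ξ, t ^ 4 * p t ^ (3 / 2 : ℝ) * (R n fun k => v k t / p t) =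
          ∫ t in (0 : ℝ)..ξ, t ^ 4 * (pPowMap * S.coeff n).extend t := by
        apply intervalIntegral.integral_congr
        intro t ht
        have ht' := mem_Icc_of_mem_uIcc ξ.2 ht
        simp only [Profile.extend_apply _ ht', ContinuousMap.mul_apply, hcoef, mul_assoc]
        congr 2
        refine R_congr fun k _ hk => ?_
        rw [ih k (Nat.lt_succ_of_le hk)]
      rw [h2, ← sq_mul_averaging]
      -- At `ξ = 0` the convention `0⁻¹ = 0` gives `v` the value `0`, as does the factor `ξ ^ 3` in
      -- `averaging`.
      by_cases hξ : (ξ : ℝ) = 0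
      · simp [hξ, averaging_apply]
      · field_simp

/-- The profiles of the arcs: solutions of the integral equation, with the boundary value analytic
in the parameter and expanded by the numbers `c n`. -/
theorem exists_arc_profile : ∃ C : ℝ → ℝ, AnalyticAt ℝ C 0 ∧ C 0 = 0 ∧
    HasExpansion C heightSeries ∧ ∀ᶠ δ in 𝓝 (0 : ℝ), ∃ V : ℝ → ℝ, Continuous V ∧
      (∀ t, |V t| ≤ 1 / 2) ∧ V 1 = C δ ∧
      ∀ ξ ∈ Icc (0 : ℝ) 1,
        ξ ^ 2 * V ξ = δ * ∫ t in (0 : ℝ)..ξ, t ^ 4 * (p t - V t) ^ (3 / 2 : ℝ) := by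
  obtain ⟨γ, hγ, h0, h⟩ := exists_analytic_profile
  have hev : AnalyticAt ℝ
      (fun δ => ContinuousMap.evalCLM ℝ (⟨1, by simp⟩ : Icc (0 : ℝ) 1) (γ δ)) 0 :=
    AnalyticAt.fun_comp (ContinuousLinearMap.analyticAt _ _) hγ
  refine ⟨_, hev, by simp [h0], ?_, ?_⟩
  · obtain ⟨G, hG⟩ := hγ
    convert hasExpansion_clm hG _ using 1
    ext n
    simp [heightSeries, v_eq_coeff hG h0 h, c]
  have hc : Tendsto (fun δ => -(pInvMap * γ δ)) (𝓝 0) (𝓝 0) := by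
    simpa [h0] using (continuousAt_const.mul hγ.continuousAt).neg.tendsto (f := fun δ =>
      -(pInvMap * γ δ))
  have h1 := hc.eventually eventually_binomialSum_apply
  have h2 : ∀ᶠ δ in 𝓝 0, γ δ ∈ Metric.closedBall (0 : Profile) (1 / 2) :=
    hγ.continuousAt.tendsto.eventually
      (h0.symm ▸ Metric.closedBall_mem_nhds (0 : Profile) one_half_pos)
  filter_upwards [h, h1, h2] with δ hδ h1 h2
  have hV : ∀ t, |(γ δ).extend t| ≤ 1 / 2 := fun t =>
    ((γ δ).abs_extend_le t).trans (by simpa using h2)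
  refine ⟨(γ δ).extend, (γ δ).continuous_extend, hV, ?_, ?_⟩
  · simp [Profile.extend_apply]
  intro ξ hξ
  rw [Profile.extend_apply _ hξ]
  conv_lhs => rw [hδ]
  rw [ContinuousMap.smul_apply, smul_eq_mul, mul_left_comm]
  congr 1
  rw [sq_mul_averaging _ ⟨ξ, hξ⟩]
  apply intervalIntegral.integral_congr
  intro t ht
  have ht' := mem_Icc_of_mem_uIcc hξ ht
  have hp := one_le_p ht'
  have hVt := abs_le.1 (hV t)
  simp only [Profile.extend_apply _ ht', ContinuousMap.mul_apply, h1] at hVt ⊢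
  congr 1
  -- `p ^ (3 / 2) * (1 - V / p) ^ (3 / 2) = (p - V) ^ (3 / 2)`; both bases are nonnegative because
  -- `p ≥ 1` and `|V| ≤ 1 / 2`.
  rw [pPowMap_apply, ← Real.mul_rpow (by linarith)]
  · congr 1
    simp only [pInvMap_apply, ContinuousMap.neg_apply, ContinuousMap.mul_apply]
    have : p t ≠ 0 := by positivity
    field_simp
    ring
  · simp only [pInvMap_apply, ContinuousMap.neg_apply, ContinuousMap.mul_apply]
    rw [← div_eq_inv_mul, ← sub_eq_add_neg, sub_nonneg, div_le_one (by linarith)]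
    linarith

end NilpotentFocus

/-! ### The half-turn factor as an implicit function -/

namespace NilpotentFocus

open Filter Topology Asymptotics ContDiff

theorem AnalyticAt.hasExpansion {f : ℝ → ℝ} (hf : AnalyticAt ℝ f 0) :
    ∃ P, HasExpansion f P ∧ PowerSeries.coeff 0 P = f 0 := by
  obtain ⟨q, hq⟩ := hf
  exact ⟨_, hasExpansion_of_hasFPowerSeriesAt hq, by
    rw [PowerSeries.coeff_mk]
    exact hq.coeff_zero 1⟩

/-- The difference of the two sides of the matching equation with initial abscissa `1`. -/
def matchDefect (C : ℝ → ℝ) (w : ℝ × ℝ) : ℝ :=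
  w.2 ^ 4 * (1 - C (-2 * (w.1 * w.2 ^ 3))) - (1 - C (2 * w.1))

theorem analyticAt_matchDefect {C : ℝ → ℝ} (hC : AnalyticAt ℝ C 0) :
    AnalyticAt ℝ (matchDefect C) (0, 1) := by
  have h1 : AnalyticAt ℝ (fun w : ℝ × ℝ => C (-2 * (w.1 * w.2 ^ 3))) (0, 1) :=
    AnalyticAt.fun_comp (by simpa using hC)
      (analyticAt_const.mul (analyticAt_fst.mul (analyticAt_snd.pow 3)))
  have h2 : AnalyticAt ℝ (fun w : ℝ × ℝ => C (2 * w.1)) (0, 1) :=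
    AnalyticAt.fun_comp (by simpa using hC) (analyticAt_const.mul analyticAt_fst)
  exact ((analyticAt_snd.pow 4).mul (analyticAt_const.sub h1)).sub (analyticAt_const.sub h2)

/-- At `α = 0` the defect reduces to `u ^ 4 - 1`, whose derivative at `u = 1` is `4`. -/
theorem isInvertible_fderiv_matchDefect {C : ℝ → ℝ} (hC : AnalyticAt ℝ C 0) (hC0 : C 0 = 0) :
    (fderiv ℝ (matchDefect C) (0, 1) ∘L .inr ℝ ℝ ℝ).IsInvertible := by
  have h1 : HasFDerivAt (fun u : ℝ => ((0 : ℝ), u)) (.inr ℝ ℝ ℝ) 1 :=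
    (ContinuousLinearMap.inr ℝ ℝ ℝ).hasFDerivAt
  have h2 := (analyticAt_matchDefect hC).differentiableAt.hasFDerivAt.comp (1 : ℝ) h1
  have h3 : matchDefect C ∘ (fun u : ℝ => ((0 : ℝ), u)) = fun u => u ^ 4 - 1 := by
    funext u
    simp [matchDefect, hC0]
  rw [h3] at h2
  have h4 : HasDerivAt (fun u : ℝ => u ^ 4 - 1) 4 1 := by
    simpa using (hasDerivAt_pow 4 (1 : ℝ)).sub_const 1
  rw [h2.unique h4.hasFDerivAt]
  refine ⟨ContinuousLinearEquiv.unitsEquivAut ℝ (Units.mk0 4 (by norm_num)), ?_⟩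
  ext
  simp

/-- The half-turn map in the rescaled variables, and the expansion of its iterate. -/
theorem exists_halfTurn {C : ℝ → ℝ} (hC : AnalyticAt ℝ C 0) (hC0 : C 0 = 0)
    (hexp : HasExpansion C heightSeries) :
    ∃ Φ : ℝ → ℝ, ContinuousAt Φ 0 ∧ Φ 0 = 1 ∧
      (∀ᶠ w in 𝓝 ((0 : ℝ), (1 : ℝ)),
        w.2 ^ 4 * (1 - C (-2 * (w.1 * w.2 ^ 3))) = 1 - C (2 * w.1) → w.2 = Φ w.1) ∧
      ∀ᶠ α in 𝓝 (0 : ℝ), HasSum (fun n => PowerSeries.coeff n fullTurn * α ^ n)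
        (Φ α * Φ (α * Φ α ^ 3)) := by
  have hc : ContDiffAt ℝ ω (matchDefect C) (0, 1) := (analyticAt_matchDefect hC).contDiffAt
  have hi := isInvertible_fderiv_matchDefect hC hC0
  have hω : (ω : WithTop ℕ∞) ≠ 0 := by simp
  have hu : matchDefect C (0, 1) = 0 := by simp [matchDefect, hC0]
  set Φ := hc.implicitFunction hω hi with hΦ
  have hΦa : AnalyticAt ℝ Φ 0 := (hc.contDiffAt_implicitFunction hω hi).analyticAt
  have hΦ0 : Φ 0 = 1 := hc.implicitFunction_apply_self hω hi
  have hsol : ∀ᶠ x in 𝓝 (0 : ℝ), Φ x ^ 4 * (1 - C (-2 * (x * Φ x ^ 3))) = 1 - C (2 * x) := by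
    filter_upwards [hc.eventually_apply_implicitFunction hω hi] with x hx
    rw [hu] at hx
    exact sub_eq_zero.1 hx
  obtain ⟨P, hP, hP0⟩ := AnalyticAt.hasExpansion hΦa
  have hhalf : HasExpansion Φ halfTurn :=
    hasExpansion_matchCoeff hexp HasExpansion.one hP (hP0.trans hΦ0) (by simpa using hsol)
  have hβ : AnalyticAt ℝ (fun x => x * Φ x ^ 3) 0 := analyticAt_id.mul (hΦa.pow 3)
  have hΦβ : AnalyticAt ℝ (fun x => Φ (x * Φ x ^ 3)) 0 :=
    AnalyticAt.fun_comp (by simpa using hΦa) hβ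
  have hfull : AnalyticAt ℝ (fun x => Φ x * Φ (x * Φ x ^ 3)) 0 := hΦa.mul hΦβ
  refine ⟨Φ, hΦa.continuousAt, hΦ0, ?_, ?_⟩
  · filter_upwards [hc.eventually_apply_eq_iff_implicitFunction hω hi] with w hw h
    rw [hu] at hw
    exact (hw.1 (sub_eq_zero.2 h)).symm
  · obtain ⟨Q, hQ, hQ0⟩ := AnalyticAt.hasExpansion hfull
    refine HasExpansion.eventually_hasSum ?_ hfull
    refine hasExpansion_matchCoeff hexp hhalf hQ (by simp [hQ0, hΦ0]) ?_
    have ht : Tendsto (fun x => x * Φ x ^ 3) (𝓝 0) (𝓝 0) := by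
      simpa using hβ.continuousAt.tendsto
    -- The equation of `Φ` at the new parameter `x * Φ x ^ 3`, multiplied by `Φ x ^ 4`, is the
    -- matching equation between `Φ x` and the product `Φ x * Φ (x * Φ x ^ 3)`.
    filter_upwards [ht.eventually hsol] with x hx
    have e : x * (Φ x * Φ (x * Φ x ^ 3)) ^ 3 = x * Φ x ^ 3 * Φ (x * Φ x ^ 3) ^ 3 := by ring
    rw [e, mul_pow, mul_assoc, hx]

end NilpotentFocus

/-! ### The height of an arc -/

namespace NilpotentFocus

open Filter Topology

/-- Gronwall: `D ^ 2 * exp (-2 * K * t)` is nonincreasing. The derivative is required only in the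
open interval, since the variable `ξ` used on an arc is a square root that vanishes at the initial
time. -/
theorem eq_zero_of_abs_deriv_le {D D' : ℝ → ℝ} {K T : ℝ} (hT : 0 ≤ T)
    (hc : ContinuousOn D (Icc 0 T)) (h0 : D 0 = 0)
    (hd : ∀ t ∈ Ioo 0 T, HasDerivAt D (D' t) t) (hb : ∀ t ∈ Ioo 0 T, |D' t| ≤ K * |D t|) :
    D T = 0 := by
  have hder : ∀ t ∈ Ioo 0 T, HasDerivAt (fun t => D t ^ 2 * Real.exp (-(2 * K * t)))
      ((2 * (D t * D' t) - 2 * K * D t ^ 2) * Real.exp (-(2 * K * t))) t := fun t ht => by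
    have h1 : HasDerivAt (fun t => -(2 * K * t)) (-(2 * K)) t := by
      simpa using ((hasDerivAt_id t).const_mul (2 * K)).fun_neg
    have := ((hd t ht).pow 2).mul h1.exp
    refine this.congr_deriv ?_
    simp only [Pi.pow_apply]
    push_cast
    ring
  have hanti : AntitoneOn (fun t => D t ^ 2 * Real.exp (-(2 * K * t))) (Icc 0 T) := by
    refine antitoneOn_of_deriv_nonpos (convex_Icc 0 T)
      ((hc.pow 2).mul (by fun_prop)) ?_ ?_ <;> rw [interior_Icc]
    · exact fun t ht => (hder t ht).differentiableAt.differentiableWithinAt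
    · intro t ht
      rw [(hder t ht).deriv]
      refine mul_nonpos_of_nonpos_of_nonneg ?_ (Real.exp_pos _).le
      have h1 : D t * D' t ≤ |D t| * |D' t| := by
        rw [← abs_mul]
        exact le_abs_self _
      have h2 := mul_le_mul_of_nonneg_left (hb t ht) (abs_nonneg (D t))
      have h3 : |D t| * (K * |D t|) = K * D t ^ 2 := by
        rw [← sq_abs (D t)]
        ring
      linarith
  have h := hanti (left_mem_Icc.2 hT) (right_mem_Icc.2 hT) hT
  simp only [h0] at h
  have h1 : D T ^ 2 * Real.exp (-(2 * K * T)) ≤ 0 := by simpa using h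
  have h2 : D T ^ 2 ≤ 0 := by
    by_contra hne
    exact absurd h1 (not_le.2 (mul_pos (not_le.1 hne) (Real.exp_pos _)))
  exact pow_eq_zero_iff two_ne_zero |>.1 (le_antisymm h2 (sq_nonneg _))

theorem sq_mul_p (ξ : ℝ) : ξ ^ 2 * p ξ = 1 - (1 - ξ ^ 2) ^ 4 := by
  unfold p
  ring

/-- The height at which an arc that leaves the horizontal axis at the abscissa `E` meets the
vertical axis. The sign of `s` tells whether the friction acts along or against the arc. -/
theorem sq_height_of_arc {x y V : ℝ → ℝ} {E T s : ℝ} (hE : 0 < E) (hT : 0 < T)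
    (hxc : ContinuousOn x (Icc 0 T)) (hyc : ContinuousOn y (Icc 0 T))
    (hx : ∀ t ∈ Ioo 0 T, HasDerivAt x (-y t) t)
    (hy : ∀ t ∈ Ioo 0 T, HasDerivAt y (x t ^ 3 - s * y t ^ 3) t)
    (hx0 : x 0 = E) (hy0 : y 0 = 0) (hxT : x T = 0)
    (hypos : ∀ t ∈ Ioo 0 T, 0 < y t) (hxmem : ∀ t ∈ Ioo 0 T, x t ∈ Ioo 0 E)
    (hVc : Continuous V) (hV : ∀ t, |V t| ≤ 1 / 2)
    (hint : ∀ ξ ∈ Icc (0 : ℝ) 1, ξ ^ 2 * V ξ =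
      (s * (2 * (Real.sqrt 2 * E ^ 3))) * ∫ t in (0 : ℝ)..ξ, t ^ 4 * (p t - V t) ^ (3 / 2 : ℝ)) :
    y T ^ 2 = E ^ 4 / 2 * (1 - V 1) := by
  set r : ℝ := Real.sqrt 2 with hr
  have hr2 : r ^ 2 = 2 := Real.sq_sqrt two_pos.le
  have hrpos : 0 < r := Real.sqrt_pos.2 two_pos
  set ξ : ℝ → ℝ := fun t => Real.sqrt (1 - x t / E) with hξ
  have hpc : Continuous p := by unfold p; fun_prop
  set f : ℝ → ℝ := fun t => t ^ 4 * (p t - V t) ^ (3 / 2 : ℝ) with hf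
  have hfc : Continuous f :=
    (continuous_pow 4).mul ((hpc.sub hVc).rpow_const fun _ => Or.inr (by norm_num))
  -- `W` equals `u ^ 2 * (p u - V u)` on `[0, 1]`, but in integral form it is differentiable
  -- although `V` is only known to be continuous.
  set W : ℝ → ℝ := fun u => 1 - (1 - u ^ 2) ^ 4 - (s * (2 * (r * E ^ 3))) * ∫ t in (0 : ℝ)..u, f t
    with hW
  have hWd : ∀ u, HasDerivAt W (8 * u * (1 - u ^ 2) ^ 3 - (s * (2 * (r * E ^ 3))) * f u) u := by
    intro u
    have h1 := (hfc.integral_hasStrictDerivAt 0 u).hasDerivAt.const_mul (s * (2 * (r * E ^ 3)))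
    have h2 : HasDerivAt (fun u : ℝ => 1 - (1 - u ^ 2) ^ 4) (8 * u * (1 - u ^ 2) ^ 3) u := by
      have := ((((hasDerivAt_pow 2 u).const_sub 1).pow 4).const_sub 1)
      refine this.congr_deriv ?_
      push_cast
      ring
    exact h2.sub h1
  have hWc : Continuous W := continuous_iff_continuousAt.2 fun u => (hWd u).continuousAt
  have hWeq : ∀ u ∈ Icc (0 : ℝ) 1, W u = u ^ 2 * (p u - V u) := fun u hu => by
    simp only [hW]
    rw [mul_sub, sq_mul_p, hint u hu]
  have hξc : ContinuousOn ξ (Icc 0 T) :=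
    (continuousOn_const.sub (hxc.div_const E)).sqrt
  have hξsq : ∀ t ∈ Ioo 0 T, ξ t ^ 2 = 1 - x t / E := fun t ht => by
    refine Real.sq_sqrt (sub_nonneg.2 ?_)
    rw [div_le_one hE]
    exact (hxmem t ht).2.le
  have hξpos : ∀ t ∈ Ioo 0 T, 0 < ξ t := fun t ht => by
    refine Real.sqrt_pos.2 (sub_pos.2 ?_)
    rw [div_lt_one hE]
    exact (hxmem t ht).2
  have hξle : ∀ t ∈ Ioo 0 T, ξ t ≤ 1 := fun t ht => by
    refine Real.sqrt_le_one.2 ?_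
    have := div_pos (hxmem t ht).1 hE
    linarith
  have hξd : ∀ t ∈ Ioo 0 T, HasDerivAt ξ (y t / E / (2 * ξ t)) t := fun t ht => by
    have h1 : HasDerivAt (fun t => 1 - x t / E) (y t / E) t := by
      refine (((hx t ht).div_const E).const_sub 1).congr_deriv ?_
      ring
    refine h1.sqrt ?_
    rw [← hξsq t ht]
    exact (pow_pos (hξpos t ht) 2).ne'
  set z : ℝ → ℝ := fun t => E ^ 2 / r * (ξ t * Real.sqrt (p (ξ t) - V (ξ t))) with hz
  have hzc : ContinuousOn z (Icc 0 T) := by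
    have h1 : Continuous fun u => E ^ 2 / r * (u * Real.sqrt (p u - V u)) := by fun_prop
    exact h1.comp_continuousOn hξc
  have hpV : ∀ t ∈ Ioo 0 T, 0 < p (ξ t) - V (ξ t) := fun t ht => by
    have h1 := one_le_p ⟨(hξpos t ht).le, hξle t ht⟩
    have h2 := abs_le.1 (hV (ξ t))
    linarith
  have hzW : ∀ t ∈ Ioo 0 T, z t ^ 2 = E ^ 4 / 2 * W (ξ t) := fun t ht => by
    rw [hWeq _ ⟨(hξpos t ht).le, hξle t ht⟩]
    simp only [hz, mul_pow, div_pow, hr2, Real.sq_sqrt (hpV t ht).le]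
    ring
  have hznn : ∀ t ∈ Ioo 0 T, 0 ≤ z t := fun t ht => by
    have := hξpos t ht
    positivity
  -- `z` is the height predicted by the profile. Comparing squares avoids the degeneracy at the
  -- start, where `y` and `z` vanish: the derivative of `D = (y - z) * (y + z)` has the factor `y *
  -- (y ^ 3 - z ^ 3)`, which a bounded multiple of `|D|` controls.
  set D : ℝ → ℝ := fun t => y t ^ 2 - E ^ 4 / 2 * W (ξ t) with hD
  have hDd : ∀ t ∈ Ioo 0 T, HasDerivAt D (-2 * s * y t * (y t ^ 3 - z t ^ 3)) t := fun t ht => by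
    have h1 := ((hWd (ξ t)).comp t (hξd t ht)).const_mul (E ^ 4 / 2)
    have h2 := ((hy t ht).pow 2).sub h1
    refine h2.congr_deriv ?_
    have h3 : (p (ξ t) - V (ξ t)) ^ (3 / 2 : ℝ) = Real.sqrt (p (ξ t) - V (ξ t)) ^ 3 := by
      rw [Real.sqrt_eq_rpow, ← Real.rpow_natCast, ← Real.rpow_mul (hpV t ht).le]
      norm_num
    have h4 : 1 - ξ t ^ 2 = x t / E := by rw [hξsq t ht]; ring
    have h5 := (hξpos t ht).ne'
    have h6 : r ^ 3 = 2 * r := by rw [pow_succ, hr2]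
    have h7 := hE.ne'
    simp only [hf, h3, h4, hz, mul_pow, div_pow, h6]
    set q := Real.sqrt (p (ξ t) - V (ξ t))
    field_simp
    push_cast
    have h8 : r ^ 2 = 2 := hr2
    ring_nf
    rw [h8]
    ring
  obtain ⟨M, hM⟩ := isCompact_Icc.exists_bound_of_continuousOn (hyc.norm.add hzc.norm)
  have hDT : D T = 0 := by
    refine eq_zero_of_abs_deriv_le (K := 2 * |s| * M ^ 2) hT.le ?_ ?_ hDd ?_
    · exact (hyc.pow 2).sub (continuousOn_const.mul (hWc.comp_continuousOn hξc))
    · simp [hD, hξ, hx0, hy0, hE.ne', hW]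
    · intro t ht
      have hMt := hM t (Ioo_subset_Icc_self ht)
      have hyt := hypos t ht
      have hzt := hznn t ht
      simp only [Pi.add_apply, Real.norm_eq_abs, abs_of_pos hyt, abs_of_nonneg hzt] at hMt
      rw [abs_of_pos (by linarith)] at hMt
      have h1 : D t = (y t - z t) * (y t + z t) := by
        simp only [hD]
        rw [← hzW t ht]
        ring
      have h2 : -2 * s * y t * (y t ^ 3 - z t ^ 3) =
          (-2 * s) * ((y t * (y t ^ 2 + y t * z t + z t ^ 2)) * (y t - z t)) := by ring
      have hq : 0 ≤ y t * (y t ^ 2 + y t * z t + z t ^ 2) := by positivity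
      rw [h1, h2, abs_mul (-2 * s), abs_mul _ (y t - z t), abs_mul (y t - z t), abs_mul (-2) s,
        abs_of_nonneg hq, abs_of_pos (show 0 < y t + z t by linarith), abs_neg, abs_two]
      -- The left-hand side is at most `(y + z) ^ 3`, and `y + z ≤ M`.
      have h3 : y t * (y t ^ 2 + y t * z t + z t ^ 2) ≤ M ^ 2 * (y t + z t) := by
        have h4 : (y t + z t) ^ 2 ≤ M ^ 2 := pow_le_pow_left₀ (by linarith) hMt 2
        have h5 := mul_le_mul_of_nonneg_right h4 (show 0 ≤ y t + z t by linarith)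
        refine le_trans ?_ h5
        nlinarith [mul_nonneg hyt.le hzt, mul_nonneg (mul_nonneg hyt.le hzt) hzt, pow_nonneg hzt 3,
          mul_nonneg (mul_nonneg hyt.le hyt.le) hzt]
      have h6 := mul_le_mul_of_nonneg_left
        (mul_le_mul_of_nonneg_right h3 (abs_nonneg (y t - z t)))
        (show 0 ≤ 2 * |s| by positivity)
      linarith
  have hξT : ξ T = 1 := by simp [hξ, hxT]
  have h1 : W 1 = 1 - V 1 := by
    rw [hWeq 1 (by simp)]
    norm_num [p]
  simp only [hD, hξT, h1] at hDT
  linarith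

end NilpotentFocus

/-! ### Energy estimates and the first crossing of the horizontal axis -/

namespace NilpotentFocus

open Filter Topology

theorem le_of_hasDerivAt_nonneg {f f' : ℝ → ℝ} {a b : ℝ} (hab : a ≤ b)
    (hc : ContinuousOn f (Icc a b)) (hd : ∀ t ∈ Ioo a b, HasDerivAt f (f' t) t)
    (h : ∀ t ∈ Ioo a b, 0 ≤ f' t) : f a ≤ f b := by
  refine monotoneOn_of_deriv_nonneg (convex_Icc a b) hc ?_ ?_ (left_mem_Icc.2 hab)
    (right_mem_Icc.2 hab) hab <;> rw [interior_Icc]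
  · exact fun t ht => (hd t ht).differentiableAt.differentiableWithinAt
  · intro t ht
    rw [(hd t ht).deriv]
    exact h t ht

namespace IsForwardSolution

variable {X Y : ℝ → ℝ} {ε : ℝ}

theorem hasDerivAt_fst (h : IsForwardSolution X Y) {t : ℝ} (ht : 0 < t) :
    HasDerivAt X (-Y t) t :=
  (h.deriv_fst t ht.le).hasDerivAt (Ici_mem_nhds ht)

theorem hasDerivAt_snd (h : IsForwardSolution X Y) {t : ℝ} (ht : 0 < t) :
    HasDerivAt Y (X t ^ 3 - Y t ^ 3) t :=
  (h.deriv_snd t ht.le).hasDerivAt (Ici_mem_nhds ht)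

theorem continuousOn_fst (h : IsForwardSolution X Y) : ContinuousOn X (Ici 0) := fun t ht =>
  (h.deriv_fst t ht).continuousWithinAt

theorem continuousOn_snd (h : IsForwardSolution X Y) : ContinuousOn Y (Ici 0) := fun t ht =>
  (h.deriv_snd t ht).continuousWithinAt

theorem Icc_fst (h : IsForwardSolution X Y) {a : ℝ} (b : ℝ) (ha : 0 ≤ a) :
    ContinuousOn X (Icc a b) := h.continuousOn_fst.mono fun _ ht => ha.trans ht.1

theorem Icc_snd (h : IsForwardSolution X Y) {a : ℝ} (b : ℝ) (ha : 0 ≤ a) :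
    ContinuousOn Y (Icc a b) := h.continuousOn_snd.mono fun _ ht => ha.trans ht.1

/-- Time translation followed by reflection at the origin. -/
theorem neg_shift (h : IsForwardSolution X Y) {T : ℝ} (hT : 0 ≤ T) :
    IsForwardSolution (fun t => -X (T + t)) (fun t => -Y (T + t)) := by
  have hm : MapsTo (fun t => T + t) (Ici (0 : ℝ)) (Ici 0) := fun t ht => add_nonneg hT ht
  have hs : ∀ t, HasDerivWithinAt (fun t => T + t) 1 (Ici 0) t := fun t =>
    ((hasDerivAt_id t).const_add T).hasDerivWithinAt
  constructor
  · intro t ht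
    refine ((h.deriv_fst (T + t) (hm ht)).comp t (hs t) hm).neg.congr_deriv ?_
    ring
  · intro t ht
    refine ((h.deriv_snd (T + t) (hm ht)).comp t (hs t) hm).neg.congr_deriv ?_
    ring

theorem hasDerivAt_energy (h : IsForwardSolution X Y) {t : ℝ} (ht : 0 < t) :
    HasDerivAt (fun t => Y t ^ 2 / 2 + X t ^ 4 / 4) (-Y t ^ 4) t := by
  refine ((((h.hasDerivAt_snd ht).pow 2).div_const 2).add
    (((h.hasDerivAt_fst ht).pow 4).div_const 4)).congr_deriv ?_
  push_cast
  ring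

theorem energy_le (h : IsForwardSolution X Y) (hX : X 0 = ε) (hY : Y 0 = 0) {t : ℝ} (ht : 0 ≤ t) :
    Y t ^ 2 / 2 + X t ^ 4 / 4 ≤ ε ^ 4 / 4 := by
  have h1 := le_of_hasDerivAt_nonneg (f := fun t => -(Y t ^ 2 / 2 + X t ^ 4 / 4)) ht
    ((((h.Icc_snd t le_rfl).pow 2).div_const 2).add
      (((h.Icc_fst t le_rfl).pow 4).div_const 4)).neg
    (fun s hs => (h.hasDerivAt_energy hs.1).fun_neg)
    (fun s _ => by rw [neg_neg]; positivity)
  simp only [hX, hY] at h1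
  linarith

theorem abs_fst_le (h : IsForwardSolution X Y) (hε : 0 ≤ ε) (hX : X 0 = ε) (hY : Y 0 = 0) {t : ℝ}
    (ht : 0 ≤ t) : |X t| ≤ ε := by
  have h1 := h.energy_le hX hY ht
  refine (pow_le_pow_iff_left₀ (abs_nonneg _) hε four_ne_zero).1 ?_
  rw [Even.pow_abs (by decide)]
  nlinarith [sq_nonneg (Y t)]

theorem abs_snd_le (h : IsForwardSolution X Y) (hX : X 0 = ε) (hY : Y 0 = 0) {t : ℝ}
    (ht : 0 ≤ t) : |Y t| ≤ ε ^ 2 := by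
  have h1 := h.energy_le hX hY ht
  refine (pow_le_pow_iff_left₀ (abs_nonneg _) (sq_nonneg _) two_ne_zero).1 ?_
  rw [sq_abs]
  nlinarith [sq_nonneg (Y t), sq_nonneg (X t ^ 2), sq_nonneg (ε ^ 2)]

/-- On the upper half-plane the energy lost is controlled by the displacement. -/
theorem energy_ge (h : IsForwardSolution X Y) (hX : X 0 = ε) (hY : Y 0 = 0)
    {τ : ℝ} (hτ : 0 ≤ τ) (hpos : ∀ t ∈ Ioo 0 τ, 0 < Y t) :
    ε ^ 4 / 4 - ε ^ 7 + ε ^ 6 * X τ ≤ Y τ ^ 2 / 2 + X τ ^ 4 / 4 := by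
  -- Since `0 < Y ≤ ε ^ 2`, the loss rate `Y ^ 4` is at most `ε ^ 6 * Y = -ε ^ 6 * X'`; hence the
  -- energy minus `ε ^ 6 * X` increases.
  have h1 := le_of_hasDerivAt_nonneg
    (f := fun t => (Y t ^ 2 / 2 + X t ^ 4 / 4) - ε ^ 6 * X t) hτ
    (((((h.Icc_snd τ le_rfl).pow 2).div_const 2).add
      (((h.Icc_fst τ le_rfl).pow 4).div_const 4)).sub
        (continuousOn_const.mul (h.Icc_fst τ le_rfl)))
    (fun s hs => (h.hasDerivAt_energy hs.1).sub ((h.hasDerivAt_fst hs.1).const_mul (ε ^ 6)))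
    (fun s hs => by
      have h2 := hpos s hs
      have h3 := (abs_le.1 (h.abs_snd_le hX hY hs.1.le)).2
      have h4 := pow_le_pow_left₀ h2.le h3 3
      have h5 : Y s * Y s ^ 3 ≤ Y s * ε ^ 6 := by
        refine mul_le_mul_of_nonneg_left (h4.trans_eq (by ring)) h2.le
      linarith)
  simp only [hX, hY] at h1
  linarith

/-- As `X ≥ -ε`, the loss is at most `2 * ε ^ 7`, which `ε ≤ 1 / 4` makes at most `ε ^ 4 / 32`. -/
theorem energy_ge_eighth (h : IsForwardSolution X Y) (hε : 0 < ε) (hε1 : ε ≤ 1 / 4)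
    (hX : X 0 = ε) (hY : Y 0 = 0)
    {τ : ℝ} (hτ : 0 ≤ τ) (hpos : ∀ t ∈ Ioo 0 τ, 0 < Y t) :
    ε ^ 4 / 8 ≤ Y τ ^ 2 / 2 + X τ ^ 4 / 4 := by
  have h1 := h.energy_ge hX hY hτ hpos
  have h2 := (abs_le.1 (h.abs_fst_le hε.le hX hY hτ)).1
  have h3 : ε ^ 6 * (-ε) ≤ ε ^ 6 * X τ := mul_le_mul_of_nonneg_left h2 (by positivity)
  have h4 : ε ^ 3 ≤ (1 / 4) ^ 3 := pow_le_pow_left₀ hε.le hε1 3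
  have h5 : ε ^ 4 * ε ^ 3 ≤ ε ^ 4 * (1 / 4) ^ 3 := mul_le_mul_of_nonneg_left h4 (by positivity)
  have h6 : 0 < ε ^ 4 := by positivity
  nlinarith

/-- An arc in the upper half-plane turns at least with constant speed. -/
theorem time_le (h : IsForwardSolution X Y) (hε : 0 < ε) (hε1 : ε ≤ 1 / 4)
    (hX : X 0 = ε) (hY : Y 0 = 0)
    {τ : ℝ} (hpos : ∀ t ∈ Ioo 0 τ, 0 < Y t) {a b : ℝ} (ha : 0 < a) (hab : a ≤ b) (hb : b < τ) :
    ε ^ 4 / 16 * (b - a) ≤ Real.pi := by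
  have hmem : ∀ t ∈ Icc a b, t ∈ Ioo 0 τ := fun t ht => ⟨ha.trans_le ht.1, ht.2.trans_lt hb⟩
  -- `-arctan (X / Y)` is the polar angle up to a constant and varies by less than `π`. Its rate is
  -- at least `ε ^ 4 / 16`: the term `X * Y ^ 3` is at most `Y ^ 2 / 2`, so the numerator is at
  -- least the energy, which is at least `ε ^ 4 / 8`, and `X ^ 2 + Y ^ 2 ≤ 2`.
  have h1 := le_of_hasDerivAt_nonneg
    (f := fun t => -Real.arctan (X t / Y t) - ε ^ 4 / 16 * t)
    (f' := fun t => (X t ^ 4 - X t * Y t ^ 3 + Y t ^ 2) / (X t ^ 2 + Y t ^ 2) - ε ^ 4 / 16)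
    hab ?_ ?_ ?_
  · have h2 := Real.arctan_lt_pi_div_two (X a / Y a)
    have h3 := Real.neg_pi_div_two_lt_arctan (X b / Y b)
    linarith
  · refine ContinuousOn.sub (ContinuousOn.neg (Real.continuous_arctan.comp_continuousOn ?_))
      (by fun_prop)
    exact (h.Icc_fst b ha.le).div (h.Icc_snd b ha.le) fun t ht => (hpos t (hmem t ht)).ne'
  · intro t ht
    have hY0 := hpos t (hmem t (Ioo_subset_Icc_self ht))
    have ht0 : 0 < t := ha.trans ht.1
    have h2 := ((h.hasDerivAt_fst ht0).fun_div (h.hasDerivAt_snd ht0) hY0.ne').arctan.fun_neg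
    have h3 : HasDerivAt (fun t => ε ^ 4 / 16 * t) (ε ^ 4 / 16) t := by
      simpa using (hasDerivAt_id t).const_mul (ε ^ 4 / 16)
    refine (h2.sub h3).congr_deriv ?_
    have h4 : X t ^ 2 + Y t ^ 2 ≠ 0 := by positivity
    have h5 : 1 + (X t / Y t) ^ 2 = (X t ^ 2 + Y t ^ 2) / Y t ^ 2 := by
      field_simp
      ring
    rw [h5]
    field_simp
    ring
  · intro t ht
    have htm := hmem t (Ioo_subset_Icc_self ht)
    have hY0 := hpos t htm
    have h2 := h.energy_ge_eighth hε hε1 hX hY htm.1.le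
      fun s hs => hpos s ⟨hs.1, hs.2.trans htm.2⟩
    have h3 := abs_le.1 (h.abs_fst_le hε.le hX hY htm.1.le)
    have h4 := abs_le.1 (h.abs_snd_le hX hY htm.1.le)
    have h5 : ε ^ 2 ≤ 1 := pow_le_one₀ hε.le (by linarith)
    rw [sub_nonneg, le_div_iff₀ (by positivity)]
    have h6 : X t * Y t ≤ 1 / 2 := by nlinarith
    have h7 : X t * Y t * Y t ^ 2 ≤ 1 / 2 * Y t ^ 2 :=
      mul_le_mul_of_nonneg_right h6 (sq_nonneg _)
    have h8 : X t ^ 2 + Y t ^ 2 ≤ 2 := by nlinarith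
    have h9 : ε ^ 4 / 16 * (X t ^ 2 + Y t ^ 2) ≤ ε ^ 4 / 16 * 2 :=
      mul_le_mul_of_nonneg_left h8 (by positivity)
    nlinarith [sq_nonneg (X t ^ 2)]

/-- The first crossing of the horizontal axis. -/
theorem exists_crossing (h : IsForwardSolution X Y) (hε : 0 < ε) (hε1 : ε ≤ 1 / 4)
    (hX : X 0 = ε) (hY : Y 0 = 0) :
    ∃ T, 0 < T ∧ Y T = 0 ∧ X T < 0 ∧ ∀ t ∈ Ioo 0 T, 0 < Y t := by
  have hstart : ∀ᶠ t in 𝓝[>] (0 : ℝ), 0 < Y t := by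
    have h1 := h.deriv_snd 0 (mem_Ici.2 le_rfl)
    rw [hX, hY] at h1
    have h2 := (hasDerivWithinAt_iff_tendsto_slope.1 h1)
    have h3 : ∀ᶠ t in 𝓝[Ici 0 \ {0}] (0 : ℝ), 0 < slope Y 0 t :=
      h2.eventually (lt_mem_nhds (by simpa using pow_pos hε 3))
    rw [Ici_sdiff_left] at h3
    filter_upwards [h3, self_mem_nhdsWithin] with t ht ht0
    rw [slope_def_field, hY, sub_zero, sub_zero] at ht
    exact (div_pos_iff_of_pos_right ht0).1 ht
  obtain ⟨t₀, ht₀, hpos₀⟩ := (mem_nhdsGT_iff_exists_Ioo_subset).1 hstart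
  have ht₀' : 0 < t₀ := ht₀
  obtain ⟨τ, hτ⟩ : ∃ τ, τ = t₀ + 1 + Real.pi / (ε ^ 4 / 16) + 1 := ⟨_, rfl⟩
  have hquot : 0 < Real.pi / (ε ^ 4 / 16) := div_pos Real.pi_pos (by positivity)
  -- Starting at `t₀ / 2` excludes the trivial zero of `Y` at time `0`. The horizon `τ` exceeds the
  -- bound of `time_le` even after the last unit of time is removed.
  have hex : ∃ t ∈ Icc (t₀ / 2) τ, Y t ≤ 0 := by
    by_contra hne
    push Not at hne
    have hpos : ∀ t ∈ Ioo 0 τ, 0 < Y t := fun t ht => by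
      by_cases hlt : t < t₀
      · exact hpos₀ ⟨ht.1, hlt⟩
      · exact hne t ⟨by linarith, ht.2.le⟩
    have h1 := h.time_le hε hε1 hX hY hpos (a := t₀ / 2) (b := τ - 1) (by linarith) (by linarith)
      (by linarith)
    have h2 : Real.pi / (ε ^ 4 / 16) < τ - 1 - t₀ / 2 := by linarith
    rw [div_lt_iff₀ (by positivity)] at h2
    linarith
  have hclosed : IsClosed {t ∈ Icc (t₀ / 2) τ | Y t ≤ 0} :=
    (h.Icc_snd τ (by linarith)).preimage_isClosed_of_isClosed isClosed_Icc isClosed_Iic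
  have hcomp : IsCompact {t ∈ Icc (t₀ / 2) τ | Y t ≤ 0} :=
    isCompact_Icc.of_isClosed_subset hclosed fun t ht => ht.1
  obtain ⟨T, hT⟩ := hcomp.exists_isLeast (by obtain ⟨t, ht, h0⟩ := hex; exact ⟨t, ht, h0⟩)
  have hT1 : t₀ / 2 ≤ T := hT.1.1.1
  have hT0 : 0 < T := by linarith
  have hpos : ∀ t ∈ Ioo 0 T, 0 < Y t := fun t ht => by
    by_cases hlt : t < t₀
    · exact hpos₀ ⟨ht.1, hlt⟩
    · by_contra hn
      have := hT.2 ⟨⟨by linarith, ht.2.le.trans hT.1.1.2⟩, not_lt.1 hn⟩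
      linarith [ht.2]
  have hleft : ∀ᶠ t in 𝓝[<] T, 0 < Y t := by
    filter_upwards [Ioo_mem_nhdsLT hT0] with t ht using hpos t ht
  have hYT : Y T = 0 := by
    refine le_antisymm hT.1.2 ?_
    have hc : Tendsto Y (𝓝[<] T) (𝓝 (Y T)) :=
      (h.hasDerivAt_snd hT0).continuousAt.tendsto.mono_left nhdsWithin_le_nhds
    exact ge_of_tendsto hc (hleft.mono fun t ht => ht.le)
  refine ⟨T, hT0, hYT, ?_, hpos⟩
  have hE := h.energy_ge_eighth hε hε1 hX hY hT0.le hpos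
  rw [hYT] at hE
  have hXne : X T ≠ 0 := fun h0 => by
    rw [h0] at hE
    have : 0 < ε ^ 4 := by positivity
    linarith
  -- If `X T > 0`, then `Y' = X ^ 3 > 0` at `T`, although `Y` is positive just before `T` and zero
  -- at `T`.
  by_contra hn
  have hXpos : 0 < X T := lt_of_le_of_ne (not_lt.1 hn) hXne.symm
  have h1 := (hasDerivAt_iff_tendsto_slope.1 (h.hasDerivAt_snd hT0))
  rw [hYT] at h1
  have h2 : ∀ᶠ t in 𝓝[≠] T, 0 < slope Y T t := h1.eventually (lt_mem_nhds (by
    have : 0 < X T ^ 3 := by positivity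
    linarith))
  have h3 : ∀ᶠ t in 𝓝[<] T, 0 < slope Y T t :=
    h2.filter_mono (nhdsWithin_mono _ fun t ht => ne_of_lt ht)
  obtain ⟨t, ht, ht', htT⟩ := (h3.and (hleft.and self_mem_nhdsWithin)).exists
  rw [slope_def_field, hYT, sub_zero] at ht
  exact absurd ht (not_lt.2 (div_nonpos_of_nonneg_of_nonpos ht'.le (sub_nonpos.2 (le_of_lt htT))))

end IsForwardSolution

end NilpotentFocus

/-! ### Matching the arcs and the return map -/

namespace NilpotentFocus

open Filter Topology

/-- The integral equation of the arcs has a small solution with boundary value `h`. -/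
def HasArcProfile (δ h : ℝ) : Prop :=
  ∃ V : ℝ → ℝ, Continuous V ∧ (∀ t, |V t| ≤ 1 / 2) ∧ V 1 = h ∧
    ∀ ξ ∈ Icc (0 : ℝ) 1,
      ξ ^ 2 * V ξ = δ * ∫ t in (0 : ℝ)..ξ, t ^ 4 * (p t - V t) ^ (3 / 2 : ℝ)

namespace IsForwardSolution

variable {X Y : ℝ → ℝ} {ε : ℝ}

/-- All energy at the crossing is in `X`, and at most `2 * ε ^ 7` is lost. This confines `-X T / ε`
near `1`, where the matching equation has only one solution. -/
theorem crossing_bounds (h : IsForwardSolution X Y) (hε : 0 < ε)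
    (hX : X 0 = ε) (hY : Y 0 = 0) {T : ℝ} (hT : 0 < T) (hYT : Y T = 0)
    (hpos : ∀ t ∈ Ioo 0 T, 0 < Y t) :
    -X T ≤ ε ∧ ε ^ 4 - 8 * ε ^ 7 ≤ X T ^ 4 := by
  have h1 := (abs_le.1 (h.abs_fst_le hε.le hX hY hT.le)).1
  have h2 := h.energy_ge hX hY hT.le hpos
  have h3 : ε ^ 6 * (-ε) ≤ ε ^ 6 * X T := mul_le_mul_of_nonneg_left h1 (by positivity)
  rw [hYT] at h2
  constructor
  · linarith
  · nlinarith

/-- The matching of the two arcs of a half turn on the vertical axis. -/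
theorem matching (h : IsForwardSolution X Y) (hε : 0 < ε)
    (hX : X 0 = ε) (hY : Y 0 = 0) {T : ℝ} (hT : 0 < T) (hYT : Y T = 0) (hXT : X T < 0)
    (hpos : ∀ t ∈ Ioo 0 T, 0 < Y t) {C₁ C₂ : ℝ}
    (h₁ : HasArcProfile (2 * (Real.sqrt 2 * ε ^ 3)) C₁)
    (h₂ : HasArcProfile (-2 * (Real.sqrt 2 * (-X T) ^ 3)) C₂) :
    (-X T) ^ 4 * (1 - C₂) = ε ^ 4 * (1 - C₁) := by
  have hanti : StrictAntiOn X (Icc 0 T) := by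
    refine strictAntiOn_of_deriv_neg (convex_Icc 0 T) (h.Icc_fst T le_rfl) ?_
    rw [interior_Icc]
    intro t ht
    rw [(h.hasDerivAt_fst ht.1).deriv]
    linarith [hpos t ht]
  obtain ⟨S, hS, hXS⟩ : ∃ S ∈ Icc 0 T, X S = 0 :=
    intermediate_value_Icc' hT.le (h.Icc_fst T le_rfl) ⟨hXT.le, by rw [hX]; exact hε.le⟩
  have hS0 : 0 < S := lt_of_le_of_ne hS.1 fun he => by
    rw [← he, hX] at hXS
    exact hε.ne' hXS
  have hST : S < T := lt_of_le_of_ne hS.2 fun he => by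
    rw [he] at hXS
    exact hXT.ne hXS
  obtain ⟨V₁, hV₁c, hV₁, hV₁C, hV₁i⟩ := h₁
  obtain ⟨V₂, hV₂c, hV₂, hV₂C, hV₂i⟩ := h₂
  have e1 := sq_height_of_arc (x := X) (y := Y) (s := 1) hε hS0 (h.Icc_fst S le_rfl)
    (h.Icc_snd S le_rfl) (fun t ht => h.hasDerivAt_fst ht.1)
    (fun t ht => by simpa using h.hasDerivAt_snd ht.1) hX hY hXS
    (fun t ht => hpos t ⟨ht.1, ht.2.trans hST⟩)
    (fun t ht => ⟨hXS ▸ hanti ⟨ht.1.le, (ht.2.trans hST).le⟩ hS ht.2,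
      hX ▸ hanti ⟨le_rfl, hT.le⟩ ⟨ht.1.le, (ht.2.trans hST).le⟩ ht.1⟩)
    hV₁c hV₁ (by simpa using hV₁i)
  have hsub : ∀ t, HasDerivAt (fun t => T - t) (-1) t := fun t => by
    simpa using (hasDerivAt_id t).const_sub T
  have hmaps : MapsTo (fun t => T - t) (Icc 0 (T - S)) (Ici 0) := fun t ht =>
    sub_nonneg.2 (ht.2.trans (by linarith))
  have hcs : ContinuousOn (fun t => T - t) (Icc 0 (T - S)) := by fun_prop
  have hmem : ∀ t ∈ Ioo 0 (T - S), T - t ∈ Ioo S T := fun t ht =>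
    ⟨by linarith [ht.2], by linarith [ht.1]⟩
  -- The second arc, run backwards from the crossing and reflected in the vertical axis, leaves the
  -- axis at `-X T` with the friction reversed.
  have e2 := sq_height_of_arc (x := fun t => -X (T - t)) (y := fun t => Y (T - t)) (s := -1)
    (E := -X T) (T := T - S) (neg_pos.2 hXT) (by linarith)
    (h.continuousOn_fst.comp hcs hmaps).neg (h.continuousOn_snd.comp hcs hmaps)
    (fun t ht => by
      have ht' := hmem t ht
      refine ((h.hasDerivAt_fst (hS0.trans ht'.1)).comp t (hsub t)).fun_neg.congr_deriv ?_
      ring)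
    (fun t ht => by
      have ht' := hmem t ht
      refine ((h.hasDerivAt_snd (hS0.trans ht'.1)).comp t (hsub t)).congr_deriv ?_
      ring)
    (by simp) (by simpa using hYT) (by simpa using hXS)
    (fun t ht => hpos _ ⟨hS0.trans (hmem t ht).1, (hmem t ht).2⟩)
    (fun t ht => by
      have ht' := hmem t ht
      have hm : T - t ∈ Icc 0 T := ⟨(hS0.trans ht'.1).le, ht'.2.le⟩
      exact ⟨neg_pos.2 (hXS ▸ hanti hS hm ht'.1), neg_lt_neg (hanti hm ⟨hT.le, le_rfl⟩ ht'.2)⟩)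
    hV₂c hV₂ (fun ξ hξ => by
      rw [hV₂i ξ hξ]
      ring)
  rw [hV₁C] at e1
  rw [hV₂C] at e2
  simp only [sub_sub_cancel] at e2
  linarith

end IsForwardSolution

/-- The half-turn map. -/
theorem exists_half_return {C Φ : ℝ → ℝ} (hC : ∀ᶠ δ in 𝓝 (0 : ℝ), HasArcProfile δ (C δ))
    (hΦ : ∀ᶠ w in 𝓝 ((0 : ℝ), (1 : ℝ)),
      w.2 ^ 4 * (1 - C (-2 * (w.1 * w.2 ^ 3))) = 1 - C (2 * w.1) → w.2 = Φ w.1) :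
    ∃ ε₀ : ℝ, 0 < ε₀ ∧ ∀ ε : ℝ, 0 < ε → ε < ε₀ → ∀ X Y : ℝ → ℝ, IsForwardSolution X Y →
      X 0 = ε → Y 0 = 0 → ∃ T, 0 < T ∧ Y T = 0 ∧ (∀ t ∈ Ioo 0 T, 0 < Y t) ∧
        X T < 0 ∧ -X T ≤ ε ∧ -X T = ε * Φ (Real.sqrt 2 * ε ^ 3) := by
  obtain ⟨η, hη, hCη⟩ := Metric.eventually_nhds_iff.1 hC
  obtain ⟨κ, hκ, hΦκ⟩ := Metric.eventually_nhds_iff.1 hΦ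
  have hlim : Tendsto (fun ε : ℝ => 2 * (Real.sqrt 2 * ε ^ 3)) (𝓝 0) (𝓝 0) := by
    have : Continuous fun ε : ℝ => 2 * (Real.sqrt 2 * ε ^ 3) := by fun_prop
    simpa using this.tendsto 0
  have hlim' : Tendsto (fun ε : ℝ => 8 * ε ^ 3) (𝓝 0) (𝓝 0) := by
    have : Continuous fun ε : ℝ => 8 * ε ^ 3 := by fun_prop
    simpa using this.tendsto 0
  have hsmall : ∀ᶠ ε in 𝓝 (0 : ℝ), 2 * (Real.sqrt 2 * ε ^ 3) < min η κ ∧ 8 * ε ^ 3 < κ ∧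
      8 * ε ^ 3 < 1 :=
    (hlim.eventually (gt_mem_nhds (lt_min hη hκ))).and
      ((hlim'.eventually (gt_mem_nhds hκ)).and (hlim'.eventually (gt_mem_nhds one_pos)))
  obtain ⟨μ, hμ, hμs⟩ := Metric.eventually_nhds_iff.1 hsmall
  refine ⟨min μ (1 / 4), by positivity, fun ε hε hεlt X Y h hX hY => ?_⟩
  obtain ⟨hs1, hs2, hs3⟩ := hμs (y := ε) (by
    rw [Real.dist_eq, sub_zero, abs_of_pos hε]
    exact hεlt.trans_le (min_le_left _ _))
  obtain ⟨T, hT, hYT, hXT, hpos⟩ :=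
    h.exists_crossing hε (hεlt.le.trans (min_le_right _ _)) hX hY
  obtain ⟨hG1, hG4⟩ := h.crossing_bounds hε hX hY hT hYT hpos
  refine ⟨T, hT, hYT, hpos, hXT, hG1, ?_⟩
  obtain ⟨G, hG⟩ : ∃ G, G = -X T := ⟨_, rfl⟩
  have hG0 : 0 < G := by rw [hG]; linarith
  have hX4 : X T ^ 4 = G ^ 4 := by rw [hG]; ring
  rw [hX4] at hG4
  rw [← hG] at hG1 ⊢
  have hr : 0 < Real.sqrt 2 := Real.sqrt_pos.2 two_pos
  have hε3 : 0 < ε ^ 3 := pow_pos hε 3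
  have hG3 : G ^ 3 ≤ ε ^ 3 := pow_le_pow_left₀ hG0.le hG1 3
  have hrG : Real.sqrt 2 * G ^ 3 ≤ Real.sqrt 2 * ε ^ 3 := mul_le_mul_of_nonneg_left hG3 hr.le
  have hrε : 0 < Real.sqrt 2 * ε ^ 3 := by positivity
  have hrG0 : 0 < Real.sqrt 2 * G ^ 3 := by positivity
  have hm := h.matching hε hX hY hT hYT hXT hpos
    (hCη (y := 2 * (Real.sqrt 2 * ε ^ 3)) (by
      rw [Real.dist_eq, sub_zero, abs_of_pos (by positivity)]
      exact hs1.trans_le (min_le_left _ _)))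
    (hCη (y := -2 * (Real.sqrt 2 * (-X T) ^ 3)) (by
      rw [← hG, Real.dist_eq, sub_zero, abs_of_neg (by linarith)]
      have := hs1.trans_le (min_le_left _ _)
      linarith))
  rw [← hG] at hm
  obtain ⟨g, hg⟩ : ∃ g, g = G / ε := ⟨_, rfl⟩
  have hGg : G = ε * g := by
    rw [hg]
    field_simp
  have hg0 : 0 < g := by rw [hg]; positivity
  have hg1 : g ≤ 1 := by rw [hg, div_le_one hε]; exact hG1
  have hε4 : 0 < ε ^ 4 := pow_pos hε 4
  have hg4 : 1 - 8 * ε ^ 3 ≤ g ^ 4 := by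
    have : ε ^ 4 * (1 - 8 * ε ^ 3) ≤ ε ^ 4 * g ^ 4 := by
      rw [← mul_pow, ← hGg]
      linarith
    exact le_of_mul_le_mul_left this hε4
  have hgle : g ^ 4 ≤ g := by
    have : g ^ 3 ≤ 1 := pow_le_one₀ hg0.le hg1
    calc g ^ 4 = g * g ^ 3 := by ring
      _ ≤ g * 1 := mul_le_mul_of_nonneg_left this hg0.le
      _ = g := mul_one g
  -- From `1 - 8 * ε ^ 3 ≤ g ^ 4 ≤ g ≤ 1` the ratio `g` is within `κ` of `1`, so local uniqueness
  -- identifies it with `Φ`.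
  have hfin := hΦκ (y := (Real.sqrt 2 * ε ^ 3, g)) (by
    rw [Prod.dist_eq, max_lt_iff, Real.dist_eq, Real.dist_eq, sub_zero, abs_of_pos hrε, abs_lt]
    have := hs1.trans_le (min_le_right _ _)
    exact ⟨by linarith, by linarith, by linarith⟩)
  rw [hGg, ← hfin]
  simp only
  have h3 : Real.sqrt 2 * ε ^ 3 * g ^ 3 = Real.sqrt 2 * G ^ 3 := by rw [hGg]; ring
  rw [h3]
  refine mul_left_cancel₀ hε4.ne' ?_
  rw [← hm, ← mul_assoc, ← mul_pow, ← hGg]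

/-- The first return map. -/
theorem exists_first_return : ∃ ε₀ : ℝ, 0 < ε₀ ∧ ∀ ε : ℝ, 0 < ε → ε < ε₀ →
    ∀ X Y : ℝ → ℝ, IsForwardSolution X Y → X 0 = ε → Y 0 = 0 →
      ∃ T : ℝ, IsFirstReturnTime X Y T ∧
        HasSum (fun n : ℕ => returnCoeff (n + 1) * ε ^ (3 * (n + 1) + 1)) (X T - ε) := by
  obtain ⟨C, hCa, hC0, hCexp, hCp⟩ := exists_arc_profile
  obtain ⟨Φ, hΦc, hΦ0, hΦ, hsum⟩ := exists_halfTurn hCa hC0 hCexp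
  obtain ⟨ε₁, hε₁, hhalf⟩ := exists_half_return (C := C) hCp hΦ
  have hlim : Tendsto (fun ε : ℝ => Real.sqrt 2 * ε ^ 3) (𝓝 0) (𝓝 0) := by
    have : Continuous fun ε : ℝ => Real.sqrt 2 * ε ^ 3 := by fun_prop
    simpa using this.tendsto 0
  obtain ⟨ε₂, hε₂, hsum₂⟩ := Metric.eventually_nhds_iff.1 (hlim.eventually hsum)
  refine ⟨min ε₁ ε₂, lt_min hε₁ hε₂, fun ε hε hεlt X Y h hX hY => ?_⟩
  obtain ⟨T, hT, hYT, hpos, hXT, hle, hGΦ⟩ :=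
    hhalf ε hε (hεlt.trans_le (min_le_left _ _)) X Y h hX hY
  obtain ⟨S, hS, hYS, hpos', hXS, hle', hGΦ'⟩ :=
    hhalf (-X T) (neg_pos.2 hXT) ((hle.trans_lt hεlt).trans_le (min_le_left _ _)) _ _
      (h.neg_shift hT.le) (by simp) (by simpa using hYT)
  simp only [neg_neg, neg_neg_iff_pos, neg_eq_zero] at hYS hXS hGΦ'
  refine ⟨T + S, ⟨by linarith, by linarith, hYS, ?_⟩, ?_⟩
  -- Before `T + S` the orbit meets the horizontal axis only at `T`, where `X` is negative.
  · rintro t ht ⟨hXt, hYt⟩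
    rcases lt_trichotomy t T with hlt | rfl | hgt
    · exact (hpos t ⟨ht.1, hlt⟩).ne' hYt
    · linarith
    · have := hpos' (t - T) ⟨by linarith, by linarith [ht.2]⟩
      simp only [add_sub_cancel] at this
      linarith
  · have h1 := (hsum₂ (y := ε) (by
      rw [Real.dist_eq, sub_zero, abs_of_pos hε]
      exact hεlt.trans_le (min_le_right _ _))).mul_left ε
    have h2 : Real.sqrt 2 * (-X T) ^ 3 = Real.sqrt 2 * ε ^ 3 * Φ (Real.sqrt 2 * ε ^ 3) ^ 3 := by
      rw [hGΦ]
      ring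
    have h3 : X (T + S) = ε * (Φ (Real.sqrt 2 * ε ^ 3) *
        Φ (Real.sqrt 2 * ε ^ 3 * Φ (Real.sqrt 2 * ε ^ 3) ^ 3)) := by
      rw [hGΦ', h2, hGΦ]
      ring
    rw [← h3] at h1
    -- The term of order `0` is `ε` itself and moves to the other side.
    have h4 := (hasSum_nat_add_iff' 1).2 h1
    have h5 : PowerSeries.coeff 0 fullTurn = 1 := coeff_zero_mk_matchCoeff _
    simp only [Finset.sum_range_one, h5, pow_zero, mul_one] at h4
    refine h4.congr_fun fun n => ?_
    rw [returnCoeff]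
    ring

end NilpotentFocus

/-! ### Global existence of solutions -/

namespace NilpotentFocus

open Filter Topology NNReal

/-- A bounded Lipschitz vector field has forward solutions for all times. -/
theorem exists_forward_solution {E : Type*} [NormedAddCommGroup E] [NormedSpace ℝ E]
    [CompleteSpace E] {F : E → E} {K L : ℝ≥0} (hK : LipschitzWith K F) (hL : ∀ z, ‖F z‖ ≤ L)
    (z₀ : E) :
    ∃ Z : ℝ → E, Z 0 = z₀ ∧ ∀ t ∈ Ici (0 : ℝ), HasDerivWithinAt Z (F (Z t)) (Ici 0) t := by
  have hex : ∀ n : ℕ, ∃ α : ℝ → E, α 0 = z₀ ∧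
      ∀ t ∈ Icc (0 : ℝ) n, HasDerivWithinAt α (F (α t)) (Icc 0 n) t := fun n => by
    -- With speed at most `L`, a ball of radius `L * n` cannot be left before time `n`, so
    -- Picard–Lindelöf covers all of `[0, n]`.
    have hpl : IsPicardLindelof (fun _ => F) (tmin := 0) (tmax := n) ⟨0, by simp⟩ z₀ (L * n) 0
        L K :=
      { lipschitzOnWith := fun t _ => hK.lipschitzOnWith
        continuousOn := fun x _ => continuousOn_const
        norm_le := fun t _ x _ => hL x
        mul_max_le := by simp }
    exact hpl.exists_eq_forall_mem_Icc_hasDerivWithinAt₀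
  choose α hα0 hα using hex
  have hagree : ∀ m n : ℕ, m ≤ n → EqOn (α m) (α n) (Icc 0 m) := fun m n hmn => by
    have hsub : Icc (0 : ℝ) m ⊆ Icc 0 n := Icc_subset_Icc_right (by exact_mod_cast hmn)
    refine ODE_solution_unique_of_mem_Icc_right (v := fun _ => F) (s := fun _ => univ) (K := K)
      (fun t _ => hK.lipschitzOnWith) (fun t ht => (hα m t ht).continuousWithinAt) ?_
      (fun t _ => mem_univ _) (fun t ht => ((hα n t (hsub ht)).continuousWithinAt).mono hsub) ?_
      (fun t _ => mem_univ _) ((hα0 m).trans (hα0 n).symm)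
    · intro t ht
      exact (hα m t ⟨ht.1, ht.2.le⟩).mono_of_mem_nhdsWithin
        (mem_of_superset (Icc_mem_nhdsGE ht.2) (Icc_subset_Icc_left ht.1))
    · intro t ht
      have hlt : t < n := ht.2.trans_le (by exact_mod_cast hmn)
      exact (hα n t ⟨ht.1, hlt.le⟩).mono_of_mem_nhdsWithin
        (mem_of_superset (Icc_mem_nhdsGE hlt) (Icc_subset_Icc_left ht.1))
  -- The shift by one keeps `t` strictly before the right end of its interval, as a derivative
  -- within `Ici 0` requires.
  set Z : ℝ → E := fun t => α (⌊t⌋₊ + 1) t with hZ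
  have hZα : ∀ n : ℕ, ∀ t ∈ Ico (0 : ℝ) n, Z t = α n t := fun n t ht => by
    have hn : ⌊t⌋₊ + 1 ≤ n := (Nat.floor_lt ht.1).2 ht.2
    exact hagree _ n hn ⟨ht.1, by exact_mod_cast (Nat.lt_floor_add_one t).le⟩
  refine ⟨Z, by simp [hZ, hα0], fun t ht => ?_⟩
  have htn : t < (⌊t⌋₊ + 1 : ℕ) := by exact_mod_cast Nat.lt_floor_add_one t
  have hmem : Ico (0 : ℝ) (⌊t⌋₊ + 1 : ℕ) ∈ 𝓝[Ici 0] t :=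
    inter_mem self_mem_nhdsWithin (mem_nhdsWithin_of_mem_nhds (Iio_mem_nhds htn))
  have h1 := hα (⌊t⌋₊ + 1) t ⟨ht, htn.le⟩
  have h2 : HasDerivWithinAt (α (⌊t⌋₊ + 1)) (F (α (⌊t⌋₊ + 1) t)) (Ici 0) t :=
    h1.mono_of_mem_nhdsWithin (mem_of_superset hmem Ico_subset_Icc_self)
  refine h2.congr_of_eventuallyEq ?_ (hZα _ t ⟨ht, htn⟩)
  filter_upwards [hmem] with s hs using hZα _ s hs

/-- The vector field of the system, with the arguments truncated to `[-1, 1]`. -/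
def truncatedField (z : ℝ × ℝ) : ℝ × ℝ :=
  (-(max (-1) (min 1 z.2)), max (-1) (min 1 z.1) ^ 3 - max (-1) (min 1 z.2) ^ 3)

theorem abs_truncate_le (x : ℝ) : |max (-1) (min 1 x)| ≤ 1 :=
  abs_le.2 ⟨le_max_left _ _, max_le (by norm_num) (min_le_left _ _)⟩

theorem truncate_eq {x : ℝ} (h : |x| ≤ 1) : max (-1) (min 1 x) = x := by
  rw [min_eq_right (abs_le.1 h).2, max_eq_right (abs_le.1 h).1]

theorem abs_truncate_sub_le (x y : ℝ) : |max (-1) (min 1 x) - max (-1) (min 1 y)| ≤ |x - y| := by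
  have h := abs_max_sub_max_le_max (-1) (min 1 x) (-1) (min 1 y)
  have h' := abs_min_sub_min_le_max 1 x 1 y
  rw [sub_self, abs_zero, max_eq_right (abs_nonneg (min 1 x - min 1 y))] at h
  rw [sub_self, abs_zero, max_eq_right (abs_nonneg (x - y))] at h'
  exact h.trans h'

theorem abs_cube_sub_cube_le {a b : ℝ} (ha : |a| ≤ 1) (hb : |b| ≤ 1) :
    |a ^ 3 - b ^ 3| ≤ 3 * |a - b| := by
  have h : a ^ 3 - b ^ 3 = (a ^ 2 + a * b + b ^ 2) * (a - b) := by ring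
  have h1 := abs_le.1 ha
  have h2 := abs_le.1 hb
  rw [h, abs_mul]
  refine mul_le_mul_of_nonneg_right (abs_le.2 ⟨?_, ?_⟩) (abs_nonneg _) <;> nlinarith

theorem lipschitzWith_truncatedField : LipschitzWith 6 truncatedField := by
  refine LipschitzWith.of_dist_le_mul fun z w => ?_
  have h1 : |z.1 - w.1| ≤ dist z w := le_max_left _ _
  have h2 : |z.2 - w.2| ≤ dist z w := le_max_right _ _
  have h3 := abs_truncate_sub_le z.1 w.1
  have h4 := abs_truncate_sub_le z.2 w.2
  have h5 := abs_cube_sub_cube_le (abs_truncate_le z.1) (abs_truncate_le w.1)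
  have h6 := abs_cube_sub_cube_le (abs_truncate_le z.2) (abs_truncate_le w.2)
  rw [Prod.dist_eq, max_le_iff]
  simp only [truncatedField, Real.dist_eq, NNReal.coe_ofNat]
  have h0 : 0 ≤ dist z w := dist_nonneg
  constructor
  · rw [neg_sub_neg, abs_sub_comm]
    linarith
  · rw [sub_sub_sub_comm]
    refine (abs_sub _ _).trans ?_
    linarith

theorem norm_truncatedField_le (z : ℝ × ℝ) : ‖truncatedField z‖ ≤ (2 : ℝ≥0) := by
  have h1 := abs_truncate_le z.1
  have h2 := abs_truncate_le z.2
  have h3 : |max (-1) (min 1 z.1) ^ 3| ≤ 1 := by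
    rw [abs_pow]
    exact pow_le_one₀ (abs_nonneg _) h1
  have h4 : |max (-1) (min 1 z.2) ^ 3| ≤ 1 := by
    rw [abs_pow]
    exact pow_le_one₀ (abs_nonneg _) h2
  rw [Prod.norm_def, max_le_iff]
  simp only [truncatedField, Real.norm_eq_abs, NNReal.coe_ofNat]
  constructor
  · rw [abs_neg]
    linarith
  · refine (abs_sub _ _).trans ?_
    linarith

/-- Truncation makes the field bounded and Lipschitz. As long as the sup norm is below `1` the
truncation is inactive, so the energy stays at most `ε ^ 4 / 4 < 1 / 4`; a first time of norm `1`
would need energy at least `1 / 4`. Hence the truncated solution solves the original system. -/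
theorem exists_isForwardSolution {ε : ℝ} (hε : 0 < ε) (hε1 : ε < 1) :
    ∃ X Y : ℝ → ℝ, IsForwardSolution X Y ∧ X 0 = ε ∧ Y 0 = 0 := by
  obtain ⟨Z, hZ0, hZ⟩ := exists_forward_solution lipschitzWith_truncatedField
    norm_truncatedField_le (ε, 0)
  have hX : ∀ t ∈ Ici (0 : ℝ), HasDerivWithinAt (fun t => (Z t).1) (truncatedField (Z t)).1
      (Ici 0) t := fun t ht => (hZ t ht).fst
  have hY : ∀ t ∈ Ici (0 : ℝ), HasDerivWithinAt (fun t => (Z t).2) (truncatedField (Z t)).2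
      (Ici 0) t := fun t ht => (hZ t ht).snd
  have hZc : ContinuousOn Z (Ici 0) := fun t ht => (hZ t ht).continuousWithinAt
  have hbound : ∀ t ∈ Ici (0 : ℝ), ‖Z t‖ < 1 := by
    by_contra! hne
    obtain ⟨b, hb, hb1⟩ := hne
    have hsub : Icc 0 b ⊆ Ici (0 : ℝ) := fun t ht => ht.1
    have hclosed : IsClosed {t ∈ Icc 0 b | 1 ≤ ‖Z t‖} :=
      (hZc.mono hsub).norm.preimage_isClosed_of_isClosed isClosed_Icc isClosed_Ici
    obtain ⟨τ, hτ⟩ := (isCompact_Icc.of_isClosed_subset hclosed fun t ht => ht.1).exists_isLeast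
      ⟨b, ⟨hb, le_rfl⟩, hb1⟩
    have hτ0 : 0 ≤ τ := hτ.1.1.1
    have hlt : ∀ t ∈ Ioo 0 τ, ‖Z t‖ < 1 := fun t ht => by
      by_contra hn
      exact absurd (hτ.2 ⟨⟨ht.1.le, ht.2.le.trans hτ.1.1.2⟩, not_lt.1 hn⟩) (not_le.2 ht.2)
    have hsubτ : Icc 0 τ ⊆ Ici (0 : ℝ) := fun t ht => ht.1
    have h1 := le_of_hasDerivAt_nonneg
      (f := fun t => -((Z t).2 ^ 2 / 2 + (Z t).1 ^ 4 / 4)) (f' := fun t => (Z t).2 ^ 4) hτ0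
      (((((hZc.mono hsubτ).snd).pow 2).div_const 2).add
        ((((hZc.mono hsubτ).fst).pow 4).div_const 4)).neg
      (fun t ht => by
        have hn := hlt t ht
        rw [Prod.norm_def, max_lt_iff] at hn
        have hx := (hX t ht.1.le).hasDerivAt (Ici_mem_nhds ht.1)
        have hy := (hY t ht.1.le).hasDerivAt (Ici_mem_nhds ht.1)
        simp only [truncatedField, truncate_eq hn.1.le, truncate_eq hn.2.le] at hx hy
        refine (((hy.fun_pow 2).div_const 2).fun_add
          ((hx.fun_pow 4).div_const 4)).fun_neg.congr_deriv ?_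
        push_cast
        ring)
      (fun t _ => by positivity)
    simp only [hZ0] at h1
    have hε4 : ε ^ 4 < 1 := pow_lt_one₀ hε.le hε1 (by norm_num)
    have h2 : ‖Z τ‖ < 1 := by
      rw [Prod.norm_def, max_lt_iff, Real.norm_eq_abs, Real.norm_eq_abs]
      constructor
      · refine (pow_lt_one_iff_of_nonneg (abs_nonneg _) four_ne_zero).1 ?_
        rw [Even.pow_abs (by decide)]
        nlinarith [sq_nonneg (Z τ).2]
      · refine (pow_lt_one_iff_of_nonneg (abs_nonneg _) two_ne_zero).1 ?_
        rw [sq_abs]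
        nlinarith [sq_nonneg ((Z τ).1 ^ 2)]
    exact absurd hτ.1.2 (not_le.2 h2)
  refine ⟨fun t => (Z t).1, fun t => (Z t).2, ⟨fun t ht => ?_, fun t ht => ?_⟩, by simp [hZ0],
    by simp [hZ0]⟩ <;>
  · have hn := hbound t ht
    rw [Prod.norm_def, max_lt_iff] at hn
    have hx := hX t ht
    have hy := hY t ht
    simp only [truncatedField, truncate_eq hn.1.le, truncate_eq hn.2.le] at hx hy
    assumption

end NilpotentFocus

theorem proposition1 :
    (∃ ε₀ : ℝ, 0 < ε₀ ∧ ∀ ε : ℝ, 0 < ε → ε < ε₀ →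
      (∃ X Y : ℝ → ℝ, NilpotentFocus.IsForwardSolution X Y ∧ X 0 = ε ∧ Y 0 = 0) ∧
      (∀ X Y : ℝ → ℝ, NilpotentFocus.IsForwardSolution X Y → X 0 = ε → Y 0 = 0 →
        ∃ T : ℝ, NilpotentFocus.IsFirstReturnTime X Y T ∧
          HasSum (fun n : ℕ => NilpotentFocus.returnCoeff (n + 1) * ε ^ (3 * (n + 1) + 1))
            (X T - ε))) ∧
    NilpotentFocus.returnCoeff 1 = -(2 : ℝ) ^ (3 / 2 : ℝ) * NilpotentFocus.c 1 ∧
    NilpotentFocus.returnCoeff 2 = 16 * NilpotentFocus.c 1 ^ 2 ∧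
    NilpotentFocus.returnCoeff 3 = -(2 : ℝ) ^ (3 / 2 : ℝ) *
      (20 * NilpotentFocus.c 2 * NilpotentFocus.c 1 + 8 * NilpotentFocus.c 3
        + 49 * NilpotentFocus.c 1 ^ 3) ∧
    (∀ ξ ∈ Set.Icc (0 : ℝ) 1,
      NilpotentFocus.v 1 ξ = (ξ ^ 2)⁻¹ *
        ∫ t in (0 : ℝ)..ξ, t ^ 4 * NilpotentFocus.p t ^ (3 / 2 : ℝ)) ∧
    (∀ ξ ∈ Set.Icc (0 : ℝ) 1,
      NilpotentFocus.v 2 ξ = -(3 / 2) * (ξ ^ 2)⁻¹ *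
        ∫ t in (0 : ℝ)..ξ, t ^ 4 * NilpotentFocus.p t ^ (1 / 2 : ℝ) * NilpotentFocus.v 1 t) ∧
    (∀ ξ ∈ Set.Icc (0 : ℝ) 1,
      NilpotentFocus.v 3 ξ = (ξ ^ 2)⁻¹ *
        ∫ t in (0 : ℝ)..ξ, t ^ 4 *
          (-(3 / 2) * NilpotentFocus.p t ^ (1 / 2 : ℝ) * NilpotentFocus.v 2 t
            + (3 / 8) * (NilpotentFocus.v 1 t ^ 2 / NilpotentFocus.p t ^ (1 / 2 : ℝ)))) := by
  obtain ⟨ε₀, hε₀, hret⟩ := NilpotentFocus.exists_first_return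
  refine ⟨⟨min ε₀ 1, lt_min hε₀ one_pos, fun ε hε hlt => ⟨?_, ?_⟩⟩,
    NilpotentFocus.returnCoeff_one, NilpotentFocus.returnCoeff_two,
    NilpotentFocus.returnCoeff_three, fun ξ _ => NilpotentFocus.v_one_eq ξ,
    fun ξ hξ => NilpotentFocus.v_two_eq hξ, fun ξ hξ => NilpotentFocus.v_three_eq hξ⟩
  · exact NilpotentFocus.exists_isForwardSolution hε (hlt.trans_le (min_le_right _ _))
  · exact hret ε hε (hlt.trans_le (min_le_left _ _))
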